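/- Theorem 2.4 (Discrimination strategy). Let $\mathcal H$ be a finite-dimensional complex Hilbert space, write $\mathcal B(\mathcal K)$ for the operators on a finite-dimensional Hilbert space $\mathcal K$ and, for a subspace $\mathcal V\subseteq\mathcal H$, write $\mathcal B(\mathcal V)\subseteq\mathcal B(\mathcal H)$ for the operators with range and support in $\mathcal V$. A channel is a completely positive trace-preserving linear map. Definitions. - A channel $T$ on $\mathcal B(\mathcal H)$ is a *channel with vacuum* $v$ if $v\in\mathcal H$ is a unit vector and $T(|v\rangle\langle v|)$ is a pure state. It is *isometric on* $\mathcal V$ if there is an isometry $W:\mathcal V\to\mathcal H$ with $T(\rho)=W\rho W^\dagger$ for all $\rho\in\mathcal B(\mathcal V)$. - For $N\ge 1$, an *$N$-step discrimination strategy* $D$ with ancillary space $\mathcal H_Z$ consists of Hilbert spaces $\mathcal H_i,\mathcal H_o$, a state $s_0$ on $\mathcal H_i$, and channels $\Lambda_0:\mathcal B(\mathcal H_i)\to\mathcal B(\mathcal H\otimes\mathcal H_Z)$, $\Lambda_n:\mathcal B(\mathcal H\otimes\mathcal H_Z)\to\mathcal B(\mathcal H\otimes\mathcal H_Z)$ for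 $1\le n\le N-1$, and $\Lambda_N:\mathcal B(\mathcal H\otimes\mathcal H_Z)\to\mathcal B(\mathcal H_o)$. For a linear map $S$ on $\mathcal B(\mathcal H)$ put $\rho_0^S=\Lambda_0(s_0)$ and $\rho_n^S=\Lambda_n\big((S\otimes\mathrm{id})(\rho_{n-1}^S)\big)$ for $1\le n\le N$. - For sets $\mathcal C_A,\mathcal C_B$ of channels and a two-valued POVM $\Pi=\{\pi_A,\pi_B\}$ on $\mathcal H_o$, the *error probability* is $$P_e(D,\Pi)=\tfrac12\Big[\sup_{T\in\mathcal C_A}\operatorname{tr}(\pi_B\rho_N^T)+\sup_{T\in\mathcal C_B}\operatorname{tr}(\pi_A\rho_N^T)\Big],$$ where the supremum over the empty set is $0$. - Let $T$ be a channel with vacuum $v$ and let $V:\mathcal H\to\mathcal H_E\otimes\mathcal H$ be any Stinespring isometry of $T$, that is, an isometry with $T(\rho)=\operatorname{tr}_E(V\rho V^\dagger)$. Let $P_v$ and $P_v^\perp$ be the orthogonal projections onto the support and the kernel of $\operatorname{tr}_{\mathcal H}(V|v\rangle\langle v|V^\dagger)$, and put $T^\downarrow(\rho)=\operatorname{tr}_E\big((P_v\otimes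 1)V\rho V^\dagger\big)$ and $\mathfrak i_T(\rho)=\operatorname{tr}\big(P_v^\perp\operatorname{tr}_{\mathcal H}(V\rho V^\dagger)\big)$. The *interaction probability* is $$P_I^T(D)=\sum_{n=0}^{N-1}\mathfrak i_T\big(\operatorname{tr}_Z\rho_n^{T^\downarrow}\big).$$ It does not depend on the choice of $V$. - $\mathcal C_A$ and $\mathcal C_B$ *can be discriminated in an interaction-free manner* if for all $\varepsilon,\delta>0$ there are $N\ge 1$, an $N$-step discrimination strategy $D$ and a two-valued POVM $\Pi$ with $P_e(D,\Pi)<\varepsilon$ and $P_I^T(D)<\delta$ for all $T\in\mathcal C_A\cup\mathcal C_B$. Statement. Let $\mathcal C_A,\mathcal C_B$ be closed sets of channels on $\mathcal B(\mathcal H)$, let $\mathcal V$ be a subspace of $\mathcal H$ and let $v\in\mathcal V$. Suppose that 1. every $T\in\mathcal C_A\cup\mathcal C_B$ is a channel with vacuum $v$; 2. every $T\in\mathcal C_A$ is isometric on $\mathcal V$; 3. the set $\{T|_{\mathcal B(\mathcal V)} : T\in\mathcal C_A\}$ contains exactly one element; 4. the sets $\{T|_{\mathcal B(\mathcal V)}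 : T\in\mathcal C_A\}$ and $\{T|_{\mathcal B(\mathcal V)} : T\in\mathcal C_B\}$ are disjoint. Then there exist a constant $C$ and, for every integer $N\ge 1$, an $N$-step discrimination strategy $D$ whose ancillary space is a single qubit, $\mathcal H_Z=\mathbb C^2$, and a two-valued POVM $\Pi$, such that $$P_e(D,\Pi)\le\frac{C}{N^2},\qquad P_I^{T_A}(D)=0,\qquad P_I^{T_B}(D)\le\frac CN$$ for all $T_A\in\mathcal C_A$ and all $T_B\in\mathcal C_B$. In particular, $\mathcal C_A$ and $\mathcal C_B$ can be discriminated in an interaction-free manner. -/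

import Mathlib

open scoped TensorProduct Topology

namespace InteractionFree

noncomputable section

/-- Operators on a finite-dimensional Hilbert space `H` (there, every operator is bounded and of
trace class). -/
abbrev Op (H : Type*) [AddCommGroup H] [Module ℂ H] : Type _ := H →ₗ[ℂ] H

/-- Linear maps taking operators on `H` to operators on `K`. -/
abbrev SuperOp (H K : Type*) [AddCommGroup H] [Module ℂ H] [AddCommGroup K] [Module ℂ K] :
    Type _ := Op H →ₗ[ℂ] Op K

/-- The Hilbert space `ℂ^k`. -/
abbrev Cn (k : ℕ) : Type := EuclideanSpace ℂ (Fin k)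

section Basic

set_option linter.unusedSectionVars false
set_option linter.unusedSimpArgs false

variable {H K Z E I O : Type*}
  [NormedAddCommGroup H] [InnerProductSpace ℂ H] [FiniteDimensional ℂ H]
  [NormedAddCommGroup K] [InnerProductSpace ℂ K] [FiniteDimensional ℂ K]
  [NormedAddCommGroup Z] [InnerProductSpace ℂ Z] [FiniteDimensional ℂ Z]
  [NormedAddCommGroup E] [InnerProductSpace ℂ E] [FiniteDimensional ℂ E]
  [NormedAddCommGroup I] [InnerProductSpace ℂ I] [FiniteDimensional ℂ I]
  [NormedAddCommGroup O] [InnerProductSpace ℂ O] [FiniteDimensional ℂ O]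

/-! ### Tensor products of operators, `T ⊗ id`, and partial traces -/

/-- `T ⊗ id_Z`, the linear map with `A ⊗ B ↦ T A ⊗ B`. -/
def ampl (Z : Type*) [NormedAddCommGroup Z] [InnerProductSpace ℂ Z] [FiniteDimensional ℂ Z]
    (T : SuperOp H K) : SuperOp (H ⊗[ℂ] Z) (K ⊗[ℂ] Z) :=
  (homTensorHomEquiv ℂ K Z K Z).toLinearMap ∘ₗ
    TensorProduct.map T (LinearMap.id : Op Z →ₗ[ℂ] Op Z) ∘ₗ
      (homTensorHomEquiv ℂ H Z H Z).symm.toLinearMap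

theorem ampl_map (T : SuperOp H K) (A : Op H) (B : Op Z) :
    ampl Z T (TensorProduct.map A B) = TensorProduct.map (T A) B := by
  have h : (homTensorHomEquiv ℂ H Z H Z).symm (TensorProduct.map A B) = A ⊗ₜ[ℂ] B := by
    rw [LinearEquiv.symm_apply_eq]; simp
  simp [ampl, h]

/-- The partial trace over the second tensor factor, `A ⊗ B ↦ tr(B) A`. -/
def ptraceRight : Op (H ⊗[ℂ] Z) →ₗ[ℂ] Op H :=
  (TensorProduct.rid ℂ (Op H)).toLinearMap ∘ₗ
    TensorProduct.map (LinearMap.id : Op H →ₗ[ℂ] Op H) (LinearMap.trace ℂ Z) ∘ₗ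
      (homTensorHomEquiv ℂ H Z H Z).symm.toLinearMap

theorem ptraceRight_map (A : Op H) (B : Op Z) :
    ptraceRight (TensorProduct.map A B) = LinearMap.trace ℂ Z B • A := by
  have h : (homTensorHomEquiv ℂ H Z H Z).symm (TensorProduct.map A B) = A ⊗ₜ[ℂ] B := by
    rw [LinearEquiv.symm_apply_eq]; simp
  simp [ptraceRight, h]

/-- The partial trace over the first tensor factor, `A ⊗ B ↦ tr(A) B`. -/
def ptraceLeft : Op (E ⊗[ℂ] H) →ₗ[ℂ] Op H :=
  (TensorProduct.lid ℂ (Op H)).toLinearMap ∘ₗ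
    TensorProduct.map (LinearMap.trace ℂ E) (LinearMap.id : Op H →ₗ[ℂ] Op H) ∘ₗ
      (homTensorHomEquiv ℂ E H E H).symm.toLinearMap

theorem ptraceLeft_map (A : Op E) (B : Op H) :
    ptraceLeft (TensorProduct.map A B) = LinearMap.trace ℂ E A • B := by
  have h : (homTensorHomEquiv ℂ E H E H).symm (TensorProduct.map A B) = A ⊗ₜ[ℂ] B := by
    rw [LinearEquiv.symm_apply_eq]; simp
  simp [ptraceLeft, h]

/-- The map `ρ ↦ W ρ W†`. -/
def conjBy (W : H →ₗ[ℂ] K) : SuperOp H K where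
  toFun ρ := W ∘ₗ ρ ∘ₗ LinearMap.adjoint W
  map_add' ρ σ := by simp [LinearMap.add_comp, LinearMap.comp_add]
  map_smul' c ρ := by simp [LinearMap.smul_comp, LinearMap.comp_smul]

/-! ### States and channels -/

/-- `|x⟩⟨y|`, that is, `z ↦ ⟪y, z⟫ x`. -/
def outer (x y : H) : Op H := (InnerProductSpace.rankOne ℂ x y).toLinearMap

/-- `|v⟩⟨v|`. -/
def ketbra (v : H) : Op H := outer v v

/-- Quantum states: positive semi-definite operators of trace one. -/
def IsState (ρ : Op H) : Prop := ρ.IsPositive ∧ LinearMap.trace ℂ H ρ = 1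

/-- Pure states: `|w⟩⟨w|` for a unit vector `w`. -/
def IsPure (ρ : Op H) : Prop := ∃ w : H, ‖w‖ = 1 ∧ ρ = ketbra w

/-- Complete positivity: `T ⊗ id` on `ℂ^k` is positive for every `k`. -/
def IsCompletelyPositive (T : SuperOp H K) : Prop :=
  ∀ (k : ℕ) (X : Op (H ⊗[ℂ] Cn k)), X.IsPositive → (ampl (Cn k) T X).IsPositive

/-- Quantum channels: completely positive trace-preserving maps. -/
def IsChannel (T : SuperOp H K) : Prop :=
  IsCompletelyPositive T ∧ ∀ ρ : Op H, LinearMap.trace ℂ K (T ρ) = LinearMap.trace ℂ H ρ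

/-- `T` is a channel with vacuum `v`: `v` is a unit vector and `T(|v⟩⟨v|)` is pure. -/
def IsChannelWithVacuum (T : SuperOp H H) (v : H) : Prop :=
  IsChannel T ∧ ‖v‖ = 1 ∧ IsPure (T (ketbra v))

/-- The operators on `H` with range and support in `V`, where the support of `A` is `(ker A)ᗮ`. -/
def opsOn (V : Submodule ℂ H) : Set (Op H) :=
  {A | LinearMap.range A ≤ V ∧ (LinearMap.ker A)ᗮ ≤ V}

/-- The restrictions to the operators on `V` of the maps in `C`. -/
def restrictions (V : Submodule ℂ H) (C : Set (SuperOp H H)) : Set (opsOn V → Op H) :=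
  (fun T : SuperOp H H => (opsOn V).domRestrict (T : Op H → Op H)) '' C

/-- `T` is isometric on `V`: for some isometry `W : V → H`, `T ρ = W ρ W†` for all operators `ρ`
with range and support in `V`, read as operators on `V` on the right-hand side. -/
def IsIsometricOn (T : SuperOp H H) (V : Submodule ℂ H) : Prop :=
  ∃ W : V →ₗᵢ[ℂ] H, ∀ ρ ∈ opsOn V,
    T ρ = conjBy W.toLinearMap (V.orthogonalProjectionOnto.toLinearMap ∘ₗ ρ ∘ₗ V.subtype)

/-! ### Discrimination strategies -/

/-- An `N`-step discrimination strategy (for `1 ≤ N`), with ancilla `Z`, input space `I` and output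
space `O`: the initial state `s₀`, the channel `Λ₀ = first`, the channels `Λₙ = mid n` for
`1 ≤ n ≤ N - 1`, and the channel `Λ_N = last`. The other values of `mid` are not used. -/
structure Strategy (N : ℕ) (H Z I O : Type*)
    [NormedAddCommGroup H] [InnerProductSpace ℂ H] [FiniteDimensional ℂ H]
    [NormedAddCommGroup Z] [InnerProductSpace ℂ Z] [FiniteDimensional ℂ Z]
    [NormedAddCommGroup I] [InnerProductSpace ℂ I] [FiniteDimensional ℂ I]
    [NormedAddCommGroup O] [InnerProductSpace ℂ O] [FiniteDimensional ℂ O] where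
  init : Op I
  first : SuperOp I (H ⊗[ℂ] Z)
  mid : ℕ → SuperOp (H ⊗[ℂ] Z) (H ⊗[ℂ] Z)
  last : SuperOp (H ⊗[ℂ] Z) O
  init_isState : IsState init
  first_isChannel : IsChannel first
  mid_isChannel : ∀ n, 1 ≤ n → n < N → IsChannel (mid n)
  last_isChannel : IsChannel last

/-- The intermediate states: `ρ_0 = Λ₀(s₀)` and `ρ_n = Λₙ((T ⊗ id)(ρ_{n-1}))`. Only the
values at `n ≤ N - 1` are used. -/
def Strategy.state {N : ℕ} (D : Strategy N H Z I O) (T : SuperOp H H) : ℕ → Op (H ⊗[ℂ] Z)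
  | 0 => D.first D.init
  | n + 1 => D.mid (n + 1) (ampl Z T (D.state T n))

/-- The output state `ρ_N = Λ_N((T ⊗ id)(ρ_{N-1}))`. -/
def Strategy.output {N : ℕ} (D : Strategy N H Z I O) (T : SuperOp H H) : Op O :=
  D.last (ampl Z T (D.state T (N - 1)))

/-- A two-valued POVM `{π_A, π_B}` on `O`. -/
structure POVM2 (O : Type*) [NormedAddCommGroup O] [InnerProductSpace ℂ O] where
  πA : Op O
  πB : Op O
  πA_pos : πA.IsPositive
  πB_pos : πB.IsPositive
  add_eq_one : πA + πB = 1

/-- The discrimination error probability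
`½ (sup_{T ∈ C_A} tr(π_B ρ_N^T) + sup_{T ∈ C_B} tr(π_A ρ_N^T))`. For channels the traces are real
numbers in `[0, 1]`; the supremum over an empty set is `0`. -/
def errorProb {N : ℕ} (CA CB : Set (SuperOp H H)) (D : Strategy N H Z I O) (P : POVM2 O) : ℝ :=
  (1 / 2) *
    (sSup ((fun T => (LinearMap.trace ℂ O (P.πB ∘ₗ D.output T)).re) '' CA) +
      sSup ((fun T => (LinearMap.trace ℂ O (P.πA ∘ₗ D.output T)).re) '' CB))

/-! ### Stinespring isometries -/

/-- The isometry `V : H → E ⊗ H` is a Stinespring isometry of `T`: `T ρ = tr_E(V ρ V†)`. -/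
def IsStinespring (T : SuperOp H H) (V : H →ₗᵢ[ℂ] E ⊗[ℂ] H) : Prop :=
  ∀ ρ : Op H, T ρ = ptraceLeft (conjBy V.toLinearMap ρ)

/-! ### Existence of Stinespring isometries

Hence a claim about all Stinespring isometries of a channel is never empty. -/

theorem outer_apply (x y z : H) : outer x y z = inner ℂ y z • x := by simp [outer]

theorem map_outer (x y : H) (z w : Z) :
    TensorProduct.map (outer x y) (outer z w) = outer (x ⊗ₜ[ℂ] z) (y ⊗ₜ[ℂ] w) := by
  ext a b; simp [outer_apply, TensorProduct.smul_tmul, smul_smul, mul_comm]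

theorem outer_self_isPositive (x : H) : (outer x x).IsPositive := by
  refine (LinearMap.isPositive_iff_complex _).2 fun z => ?_
  have : inner ℂ (outer x x z) z = ((‖inner ℂ x z‖^2 : ℝ) : ℂ) := by
    rw [outer_apply, inner_smul_left, ← Complex.normSq_eq_norm_sq, Complex.normSq_eq_conj_mul_self]
  rw [this]; constructor
  · simp only [RCLike.re_to_complex, Complex.ofReal_re]
  · simp only [RCLike.re_to_complex, Complex.ofReal_re]; positivity

theorem trace_outer (x y : H) : LinearMap.trace ℂ H (outer x y) = inner ℂ y x := by
  rw [LinearMap.trace_eq_sum_inner _ (stdOrthonormalBasis ℂ H)]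
  simp only [outer_apply, inner_smul_right]
  exact (OrthonormalBasis.sum_inner_mul_inner _ _ _)

/-- `id ⊗ ⟨e|`. -/
def slice (e : Z) : H ⊗[ℂ] Z →ₗ[ℂ] H :=
  (TensorProduct.rid ℂ H).toLinearMap ∘ₗ (innerSL ℂ e).toLinearMap.lTensor H

theorem inner_slice (e : Z) (y : H) (u : H ⊗[ℂ] Z) :
    inner ℂ y (slice e u) = inner ℂ (y ⊗ₜ[ℂ] e) u := by
  induction u with
  | zero => simp
  | tmul a b => simp [slice, mul_comm, inner_smul_right]
  | add a b ha hb => simp [inner_add_right, ha, hb]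

theorem slice_inner (e : Z) (y : H) (u : H ⊗[ℂ] Z) :
    inner ℂ (slice e u) y = inner ℂ u (y ⊗ₜ[ℂ] e) := by
  induction u with
  | zero => simp
  | tmul a b => simp [slice, mul_comm, inner_smul_left]
  | add a b ha hb => simp [inner_add_left, ha, hb]

theorem exists_sum_outer (J : Op H) (hJ : J.IsPositive) :
    ∃ (m : ℕ) (u : Fin m → H), J = ∑ k, outer (u k) (u k) := by
  have hs := hJ.isSymmetric
  let b := hs.eigenvectorBasis rfl
  refine ⟨_, fun k => ((Real.sqrt (hs.eigenvalues rfl k) : ℝ) : ℂ) • b k, ?_⟩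
  refine b.toBasis.ext fun i => ?_
  have h0 : 0 ≤ hs.eigenvalues rfl i := hJ.nonneg_eigenvalues rfl i
  simp only [OrthonormalBasis.coe_toBasis, LinearMap.sum_apply, outer_apply, inner_smul_left]
  rw [Finset.sum_eq_single i]
  · rw [hs.apply_eigenvectorBasis]
    rw [b.inner_eq_ite]; simp only [if_true, mul_one, Complex.conj_ofReal, smul_smul]
    rw [← Complex.ofReal_mul, Real.mul_self_sqrt h0]; rfl
  · intro k _ hk; rw [b.inner_eq_ite, if_neg hk]; simp
  · simp

/-- Kraus decomposition. -/
theorem IsCompletelyPositive.exists_kraus {T : SuperOp H H} (hT : IsCompletelyPositive T) :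
    ∃ (m : ℕ) (A : Fin m → Op H), ∀ ρ, T ρ = ∑ k, conjBy (A k) ρ := by
  let b := stdOrthonormalBasis ℂ H
  let e := EuclideanSpace.basisFun (Fin (Module.finrank ℂ H)) ℂ
  let Ω := ∑ i, b i ⊗ₜ[ℂ] e i
  have hX : outer Ω Ω = ∑ i, ∑ j, TensorProduct.map (outer (b i) (b j)) (outer (e i) (e j)) := by
    simp only [map_outer]
    ext x y
    simp only [Ω, outer, map_sum, ContinuousLinearMap.toLinearMap_sum]
    simp [sum_inner, Finset.smul_sum, Finset.sum_smul]; exact Finset.sum_comm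
  have hJ := hT _ (outer Ω Ω) (outer_self_isPositive Ω)
  obtain ⟨m, u, hu⟩ := exists_sum_outer _ hJ
  let A : Fin m → Op H := fun k => ∑ i, outer (slice (e i) (u k)) (b i)
  have hA : ∀ k i, A k (b i) = slice (e i) (u k) := by
    intro k i
    simp only [A, LinearMap.sum_apply, outer_apply, b.inner_eq_ite]
    simp
  have key : ∀ i j, T (outer (b i) (b j)) = ∑ k, outer (A k (b i)) (A k (b j)) := by
    intro i j
    ext x
    refine ext_inner_left ℂ fun y => ?_
    have h1 : inner ℂ (y ⊗ₜ[ℂ] e i) (ampl _ T (outer Ω Ω) (x ⊗ₜ[ℂ] e j))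
        = inner ℂ y (T (outer (b i) (b j)) x) := by
      rw [hX]
      simp only [map_sum, ampl_map, LinearMap.sum_apply, TensorProduct.map_tmul, outer_apply,
        inner_sum, TensorProduct.inner_tmul, inner_smul_right, e.inner_eq_ite]
      simp
    rw [← h1, hu]
    simp only [LinearMap.sum_apply, inner_sum, outer_apply, inner_smul_right, hA]
    refine Finset.sum_congr rfl fun k _ => ?_
    rw [inner_slice, slice_inner]
  have hc : ∀ k (x y : H), conjBy (A k) (outer x y) = outer (A k x) (A k y) := by
    intro k x y; ext z
    simp [conjBy, outer_apply, LinearMap.adjoint_inner_right]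
  refine ⟨m, A, fun ρ => ?_⟩
  have hρ : ρ = ∑ i, ∑ j, inner ℂ (b i) (ρ (b j)) • outer (b i) (b j) := by
    refine b.toBasis.ext fun l => ?_
    simp only [OrthonormalBasis.coe_toBasis, LinearMap.sum_apply, LinearMap.smul_apply, outer_apply,
      b.inner_eq_ite]
    simp [b.sum_repr' (ρ (b l))]
  rw [hρ]
  simp only [map_sum, map_smul, key, hc, Finset.smul_sum]
  rw [Finset.sum_comm]
  conv_rhs => rw [Finset.sum_comm]
  conv_lhs => rw [Finset.sum_comm]
  refine Finset.sum_congr rfl fun i _ => ?_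
  exact Finset.sum_comm

/-- Every channel has a Stinespring isometry. -/
theorem IsChannel.exists_isStinespring {T : SuperOp H H} (hT : IsChannel T) :
    ∃ (m : ℕ) (V : H →ₗᵢ[ℂ] Cn m ⊗[ℂ] H), IsStinespring T V := by
  obtain ⟨m, A, hA⟩ := hT.1.exists_kraus
  let e := EuclideanSpace.basisFun (Fin m) ℂ
  let V₀ : H →ₗ[ℂ] Cn m ⊗[ℂ] H := ∑ k, TensorProduct.mk ℂ (Cn m) H (e k) ∘ₗ A k
  have hV : ∀ x, V₀ x = ∑ k, e k ⊗ₜ[ℂ] A k x := by intro x; simp [V₀]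
  have hc : ∀ x y, conjBy V₀ (outer x y) = outer (V₀ x) (V₀ y) := by
    intro x y; apply LinearMap.ext; intro z
    simp [conjBy, outer_apply, LinearMap.adjoint_inner_right]
  have hcA : ∀ k (x y : H), conjBy (A k) (outer x y) = outer (A k x) (A k y) := by
    intro k x y; ext z
    simp [conjBy, outer_apply, LinearMap.adjoint_inner_right]
  have hin : ∀ x y, inner ℂ (V₀ x) (V₀ y) = inner ℂ x y := by
    intro x y
    have h := hT.2 (outer y x)
    rw [hA] at h
    simp only [hcA, map_sum, trace_outer] at h
    rw [← h, hV, hV]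
    simp [sum_inner, inner_sum, e.inner_eq_ite]
  refine ⟨m, V₀.isometryOfInner hin, fun ρ => ?_⟩
  have hk : ∀ x y, T (outer x y) = ptraceLeft (conjBy V₀ (outer x y)) := by
    intro x y
    have : outer (V₀ x) (V₀ y)
        = ∑ k, ∑ l, TensorProduct.map (outer (e k) (e l)) (outer (A k x) (A l y)) := by
      simp only [map_outer, hV]
      ext a z
      simp only [outer, map_sum, ContinuousLinearMap.toLinearMap_sum]
      simp [sum_inner, Finset.smul_sum, Finset.sum_smul]; exact Finset.sum_comm
    rw [hc, this, hA]
    simp only [hcA, map_sum, ptraceLeft_map, trace_outer, e.inner_eq_ite]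
    simp
  let b := stdOrthonormalBasis ℂ H
  have hρ : ρ = ∑ i, ∑ j, inner ℂ (b i) (ρ (b j)) • outer (b i) (b j) := by
    refine b.toBasis.ext fun l => ?_
    simp only [OrthonormalBasis.coe_toBasis, LinearMap.sum_apply, LinearMap.smul_apply, outer_apply,
      b.inner_eq_ite]
    simp [b.sum_repr' (ρ (b l))]
  change T ρ = ptraceLeft (conjBy V₀ ρ)
  rw [hρ]
  simp only [map_sum, map_smul, hk]

/-! ### The interaction probability -/

/-- `tr_H(V |v⟩⟨v| V†)`, the state of the environment when the vacuum is sent. -/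
def envState (V : H →ₗᵢ[ℂ] E ⊗[ℂ] H) (v : H) : Op E :=
  ptraceRight (conjBy V.toLinearMap (ketbra v))

/-- `P_v`, the orthogonal projection onto the support of `tr_H(V |v⟩⟨v| V†)`. -/
def suppProj (V : H →ₗᵢ[ℂ] E ⊗[ℂ] H) (v : H) : Op E :=
  ((LinearMap.ker (envState V v))ᗮ.starProjection).toLinearMap

/-- `P_v^⊥`, the orthogonal projection onto the kernel of `tr_H(V |v⟩⟨v| V†)`. -/
def kerProj (V : H →ₗᵢ[ℂ] E ⊗[ℂ] H) (v : H) : Op E :=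
  ((LinearMap.ker (envState V v)).starProjection).toLinearMap

/-- The interaction functional `ρ ↦ tr(P_v^⊥ tr_H(V ρ V†))`. -/
def interactionFunctional (V : H →ₗᵢ[ℂ] E ⊗[ℂ] H) (v : H) (ρ : Op H) : ℂ :=
  LinearMap.trace ℂ E (kerProj V v ∘ₗ ptraceRight (conjBy V.toLinearMap ρ))

/-- The quantum operation `T↓ : ρ ↦ tr_E((P_v ⊗ 1) V ρ V†)`. -/
def downOp (V : H →ₗᵢ[ℂ] E ⊗[ℂ] H) (v : H) : SuperOp H H :=
  ptraceLeft ∘ₗ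
    LinearMap.mulLeft ℂ (TensorProduct.map (suppProj V v) (LinearMap.id : Op H)) ∘ₗ
      conjBy V.toLinearMap

/-- The interaction probability `∑_{n < N} i_T(tr_Z ρ_n^{T↓})` of the strategy `D` for a channel
with Stinespring isometry `V` and vacuum `v`. The summands are non-negative real numbers. -/
def interactionProb {N : ℕ} (V : H →ₗᵢ[ℂ] E ⊗[ℂ] H) (v : H) (D : Strategy N H Z I O) : ℝ :=
  ∑ n ∈ Finset.range N, (interactionFunctional V v (ptraceRight (D.state (downOp V v) n))).re

/-- `C_A` and `C_B` can be discriminated in an interaction-free manner. Finite-dimensional Hilbert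
spaces are taken in the form `ℂ^k`; the bound on the interaction probability is required for every
Stinespring isometry of the channel. -/
def InteractionFreeDiscriminable (v : H) (CA CB : Set (SuperOp H H)) : Prop :=
  ∀ ε > (0 : ℝ), ∀ δ > (0 : ℝ), ∃ N z i o : ℕ, 1 ≤ N ∧
    ∃ (D : Strategy N H (Cn z) (Cn i) (Cn o)) (P : POVM2 (Cn o)),
      errorProb CA CB D P < ε ∧
      ∀ T ∈ CA ∪ CB, ∀ (E : Type) [NormedAddCommGroup E] [InnerProductSpace ℂ E]
        [FiniteDimensional ℂ E] (V : H →ₗᵢ[ℂ] E ⊗[ℂ] H),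
        IsStinespring T V → interactionProb V v D < δ

end Basic

end

end InteractionFree

/-!
The discrimination rests on the quantum Zeno effect. A rotation by `π / 2` is divided into `N` small
steps, one for each call of the channel: a channel in `C_A` lets it proceed undisturbed, while any
other channel acts as a measurement, and keeps the state near its start.

Let `W` be the isometry through which all maps in `C_A` act on `B(𝒱)`, choose finitely many unit
vectors in `𝒱` whose projections span `B(𝒱)`, and let `φ n` run through them periodically. The
ancillary qubit controls which vector is sent: the state before the call `n` of the channel lies in
the plane of `v ⊗ |0⟩` and `φ n ⊗ |1⟩`. After the call one checks that the state is in the plane of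
`W v ⊗ |0⟩` and `W (φ n) ⊗ |1⟩`, maps this plane to the one for `n + 1`, and rotates by
`θ = π / (2N)`; if the check fails, one starts again from the rotated vacuum (`zenoStep`).

On a channel in `C_A` the check never fails, the rotations add up to `π / 2`, and the state ends in
`W (φ (N - 1)) ⊗ |1⟩` (`zeno_state_of_isometric`).

On any other channel `T` the blocks of the state with respect to the qubit remain multiples
`q n |v⟩⟨v|` and `p n |φ n⟩⟨φ n|`, and
`√(p (n + 1)) ≤ √(r n) √(p n) + θ`, where `r n = ⟨W (φ n), T(|φ n⟩⟨φ n|) W (φ n)⟩`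
(`exists_zeno_populations`). This uses neither unitarity nor coherence of `T`. If `r n = 1` for all
`n`, then `T` agrees with the maps in `C_A` on `B(𝒱)`; since a closed set of channels is compact,
for all `T ∈ C_B` some `r n` in each period is below a common bound smaller than one
(`exists_uniform_damping`). Hence `p n = O(θ²) = O(1 / N²)`, which bounds the error probability
(`le_of_damped_recursion`).

For the interaction probability, purity of the output on the vacuum forces the Stinespring isometry
to map `v` to a product `e ⊗ w`, and for a map in `C_A` to map every `x ∈ 𝒱` to `e ⊗ W x` with the
same `e` (`eq_tmul_of_ptraceLeft_outer`). So `T↓` has the single Kraus operator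
`K = (⟨e| ⊗ 1) V`, and the interaction functional of `|x⟩⟨x|` is `‖x‖² - ‖K x‖²`. It vanishes at `v`
always and at `φ n` for `C_A`; for `C_B` the populations under `T↓` obey the same recursion, and
each call of the channel contributes at most `p n`, in total `O(1 / N)`.
-/

namespace InteractionFree

noncomputable section

/-! ### Operators on tensor products -/

section Operators

set_option linter.unusedSectionVars false

variable {H K Z E : Type*}
  [NormedAddCommGroup H] [InnerProductSpace ℂ H] [FiniteDimensional ℂ H]
  [NormedAddCommGroup K] [InnerProductSpace ℂ K] [FiniteDimensional ℂ K]
  [NormedAddCommGroup Z] [InnerProductSpace ℂ Z] [FiniteDimensional ℂ Z]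
  [NormedAddCommGroup E] [InnerProductSpace ℂ E] [FiniteDimensional ℂ E]

/-- Linear maps on `B(H ⊗ Z)` are determined by their values on product operators. -/
theorem linearMap_ext_map {M : Type*} [AddCommGroup M] [Module ℂ M] {f g : Op (H ⊗[ℂ] Z) →ₗ[ℂ] M}
    (h : ∀ (A : Op H) (B : Op Z), f (TensorProduct.map A B) = g (TensorProduct.map A B)) :
    f = g := by
  have : f ∘ₗ (homTensorHomEquiv ℂ H Z H Z).toLinearMap
      = g ∘ₗ (homTensorHomEquiv ℂ H Z H Z).toLinearMap := by
    refine TensorProduct.ext' fun A B => ?_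
    simpa using h A B
  ext X : 1
  obtain ⟨Y, rfl⟩ := (homTensorHomEquiv ℂ H Z H Z).surjective X
  exact LinearMap.congr_fun this Y

theorem trace_ptraceRight (X : Op (H ⊗[ℂ] Z)) :
    LinearMap.trace ℂ H (ptraceRight X) = LinearMap.trace ℂ _ X := by
  have : LinearMap.trace ℂ H ∘ₗ ptraceRight = LinearMap.trace ℂ (H ⊗[ℂ] Z) :=
    linearMap_ext_map fun A B => by
      simp [ptraceRight_map, LinearMap.trace_tensorProduct', mul_comm]
  exact LinearMap.congr_fun this X

theorem trace_ptraceLeft (X : Op (E ⊗[ℂ] H)) :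
    LinearMap.trace ℂ H (ptraceLeft X) = LinearMap.trace ℂ _ X := by
  have : LinearMap.trace ℂ H ∘ₗ ptraceLeft = LinearMap.trace ℂ (E ⊗[ℂ] H) :=
    linearMap_ext_map fun A B => by
      simp [ptraceLeft_map, LinearMap.trace_tensorProduct', mul_comm]
  exact LinearMap.congr_fun this X

theorem trace_comp_ptraceRight (A : Op E) (X : Op (E ⊗[ℂ] H)) :
    LinearMap.trace ℂ E (A ∘ₗ ptraceRight X)
      = LinearMap.trace ℂ _ (TensorProduct.map A (LinearMap.id : Op H) ∘ₗ X) := by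
  have : LinearMap.trace ℂ E ∘ₗ LinearMap.mulLeft ℂ A ∘ₗ ptraceRight
      = LinearMap.trace ℂ (E ⊗[ℂ] H) ∘ₗ
          LinearMap.mulLeft ℂ (TensorProduct.map A (LinearMap.id : Op H)) :=
    linearMap_ext_map fun B C => by
      simp only [LinearMap.comp_apply, ptraceRight_map, LinearMap.mulLeft_apply,
        Module.End.mul_eq_comp, map_smul, ← TensorProduct.map_comp,
        LinearMap.trace_tensorProduct', LinearMap.id_comp, smul_eq_mul, mul_comm]
  exact LinearMap.congr_fun this X

theorem trace_ampl (T : SuperOp H K) (X : Op (H ⊗[ℂ] Z)) :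
    LinearMap.trace ℂ _ (ampl Z T X) = LinearMap.trace ℂ K (T (ptraceRight X)) := by
  have : LinearMap.trace ℂ _ ∘ₗ ampl Z T = LinearMap.trace ℂ K ∘ₗ T ∘ₗ ptraceRight :=
    linearMap_ext_map fun A B => by
      simp [ampl_map, ptraceRight_map, LinearMap.trace_tensorProduct', mul_comm]
  exact LinearMap.congr_fun this X

theorem conjBy_apply (W : H →ₗ[ℂ] K) (ρ : Op H) :
    conjBy W ρ = W ∘ₗ ρ ∘ₗ LinearMap.adjoint W := rfl

theorem conjBy_comp (W : H →ₗ[ℂ] K) (U : K →ₗ[ℂ] Z) (ρ : Op H) :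
    conjBy (U ∘ₗ W) ρ = conjBy U (conjBy W ρ) := by
  simp only [conjBy_apply, LinearMap.adjoint_comp, LinearMap.comp_assoc]

theorem conjBy_outer (W : H →ₗ[ℂ] K) (x y : H) :
    conjBy W (outer x y) = outer (W x) (W y) := by
  ext z
  simp [conjBy_apply, outer_apply, LinearMap.adjoint_inner_right]

theorem conjBy_ketbra (W : H →ₗ[ℂ] K) (x : H) : conjBy W (ketbra x) = ketbra (W x) :=
  conjBy_outer W x x

theorem adjoint_rankOne_toLinearMap (x : K) (y : H) :
    LinearMap.adjoint ((InnerProductSpace.rankOne ℂ x y).toLinearMap)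
      = (InnerProductSpace.rankOne ℂ y x).toLinearMap := by
  refine ((LinearMap.eq_adjoint_iff _ _).2 fun a b => ?_).symm
  simp [inner_smul_left, inner_smul_right, mul_comm]

theorem trace_conjBy (W : H →ₗ[ℂ] K) (ρ : Op H) :
    LinearMap.trace ℂ K (conjBy W ρ)
      = LinearMap.trace ℂ H ((LinearMap.adjoint W ∘ₗ W) ∘ₗ ρ) := by
  rw [conjBy_apply, LinearMap.trace_comp_comm', LinearMap.comp_assoc,
    LinearMap.trace_comp_comm', LinearMap.comp_assoc]

theorem trace_outer_comp (x y : H) (X : Op H) :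
    LinearMap.trace ℂ H (outer x y ∘ₗ X) = inner ℂ y (X x) := by
  rw [LinearMap.trace_comp_comm']
  have : X ∘ₗ outer x y = outer (X x) y := by ext z; simp [outer_apply]
  rw [this, trace_outer]

theorem conjBy_rankOne (z : K) (u : H) (X : Op H) :
    conjBy (InnerProductSpace.rankOne ℂ z u).toLinearMap X = inner ℂ u (X u) • ketbra z := by
  ext y
  simp [conjBy_apply, adjoint_rankOne_toLinearMap, ketbra, outer_apply, smul_smul, mul_comm]

theorem ampl_conjBy (K₀ : H →ₗ[ℂ] K) (X : Op (H ⊗[ℂ] Z)) :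
    ampl Z (conjBy K₀) X = conjBy (TensorProduct.map K₀ (LinearMap.id : Op Z)) X := by
  have : ampl Z (conjBy K₀) = conjBy (TensorProduct.map K₀ (LinearMap.id : Op Z)) :=
    linearMap_ext_map fun A B => by
      simp only [ampl_map, conjBy_apply, TensorProduct.adjoint_map, ← TensorProduct.map_comp,
        LinearMap.adjoint_id, LinearMap.id_comp, LinearMap.comp_id]
  exact LinearMap.congr_fun this X

theorem slice_tmul (e : Z) (x : H) (z : Z) : slice e (x ⊗ₜ[ℂ] z) = inner ℂ e z • x := by
  simp [slice]

theorem adjoint_slice (e : Z) (y : H) :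
    LinearMap.adjoint (slice e : H ⊗[ℂ] Z →ₗ[ℂ] H) y = y ⊗ₜ[ℂ] e := by
  refine ext_inner_left ℂ fun u => ?_
  rw [LinearMap.adjoint_inner_right, slice_inner]

theorem conjBy_slice_map (e : Z) (A : Op H) (B : Op Z) :
    conjBy (slice e) (TensorProduct.map A B) = inner ℂ e (B e) • A := by
  ext y
  simp [conjBy_apply, adjoint_slice, slice_tmul]

theorem conjBy_slice_ampl (e : Z) (T : SuperOp H K) (X : Op (H ⊗[ℂ] Z)) :
    conjBy (slice e) (ampl Z T X) = T (conjBy (slice e) X) := by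
  have : conjBy (slice e) ∘ₗ ampl Z T = T ∘ₗ conjBy (slice e) :=
    linearMap_ext_map fun A B => by simp [ampl_map, conjBy_slice_map]
  exact LinearMap.congr_fun this X

theorem ptraceRight_eq_sum_conjBy_slice {ι : Type*} [Fintype ι] (e : OrthonormalBasis ι ℂ Z)
    (X : Op (H ⊗[ℂ] Z)) : ptraceRight X = ∑ i, conjBy (slice (e i)) X := by
  have : ptraceRight = ∑ i, conjBy (slice (e i) : H ⊗[ℂ] Z →ₗ[ℂ] H) :=
    linearMap_ext_map fun A B => by
      simp only [ptraceRight_map, LinearMap.sum_apply, conjBy_slice_map, ← Finset.sum_smul,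
        LinearMap.trace_eq_sum_inner _ e]
  rw [this, LinearMap.sum_apply]

theorem inner_tmul_apply_tmul (e : Z) (x y : H) (X : Op (H ⊗[ℂ] Z)) :
    inner ℂ (x ⊗ₜ[ℂ] e) (X (y ⊗ₜ[ℂ] e)) = inner ℂ x (conjBy (slice e) X y) := by
  rw [conjBy_apply, LinearMap.comp_apply, inner_slice, LinearMap.comp_apply, adjoint_slice]

/-- Matrix elements of the partial trace of `|a⟩⟨b|`. -/
theorem inner_ptraceLeft_outer (a b : E ⊗[ℂ] H) (p q : H) :
    inner ℂ p (ptraceLeft (outer a b) q) = inner ℂ (slice q b) (slice p a) := by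
  have hl : ∀ a₁ a₂ b : E ⊗[ℂ] H, outer (a₁ + a₂) b = outer a₁ b + outer a₂ b := by
    intros; ext; simp [outer]
  have hr : ∀ a b₁ b₂ : E ⊗[ℂ] H, outer a (b₁ + b₂) = outer a b₁ + outer a b₂ := by
    intros; ext; simp [outer]
  induction a with
  | zero =>
    have : outer (0 : E ⊗[ℂ] H) b = 0 := by ext; simp [outer]
    simp [this]
  | add a₁ a₂ h₁ h₂ => simp [hl, h₁, h₂]
  | tmul a₁ a₂ =>
    induction b with
    | zero =>
      have : outer (a₁ ⊗ₜ[ℂ] a₂) (0 : E ⊗[ℂ] H) = 0 := by ext; simp [outer]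
      simp [this]
    | add b₁ b₂ h₁ h₂ => simp [hr, h₁, h₂]
    | tmul b₁ b₂ =>
      rw [← map_outer, ptraceLeft_map, trace_outer]
      simp [outer_apply, slice_tmul]
      ring

theorem norm_slice_le (p : H) (u : E ⊗[ℂ] H) : ‖slice p u‖ ≤ ‖p‖ * ‖u‖ := by
  have h : ‖slice p u‖ ^ 2 ≤ ‖slice p u‖ * (‖p‖ * ‖u‖) := by
    rw [← inner_self_eq_norm_sq (𝕜 := ℂ) (slice p u), inner_slice]
    refine (re_inner_le_norm (𝕜 := ℂ) (slice p u ⊗ₜ[ℂ] p) u).trans_eq ?_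
    rw [TensorProduct.norm_tmul]; ring
  rcases (norm_nonneg (slice p u)).eq_or_lt with h0 | h0
  · rw [← h0]; positivity
  · nlinarith

end Operators

/-! ### Stinespring isometries of channels with vacuum -/

section Stinespring

set_option linter.unusedSectionVars false

variable {H E : Type*}
  [NormedAddCommGroup H] [InnerProductSpace ℂ H] [FiniteDimensional ℂ H]
  [NormedAddCommGroup E] [InnerProductSpace ℂ E] [FiniteDimensional ℂ E]

theorem linearMap_ext_outer {M : Type*} [AddCommGroup M] [Module ℂ M] {f g : Op H →ₗ[ℂ] M}
    (h : ∀ x y : H, f (outer x y) = g (outer x y)) : f = g := by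
  ext ρ : 1
  let b := stdOrthonormalBasis ℂ H
  have hρ : ρ = ∑ i, outer (ρ (b i)) (b i) := by
    refine b.toBasis.ext fun l => ?_
    simp [outer_apply, b.inner_eq_ite]
  rw [hρ, map_sum, map_sum]
  exact Finset.sum_congr rfl fun i _ => h _ _

theorem trace_ketbra (x : H) : LinearMap.trace ℂ H (ketbra x) = ((‖x‖ ^ 2 : ℝ) : ℂ) := by
  rw [ketbra, trace_outer, inner_self_eq_norm_sq_to_K]; norm_cast

theorem IsStinespring.inner_apply_outer {T : SuperOp H H} {V : H →ₗᵢ[ℂ] E ⊗[ℂ] H}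
    (hV : IsStinespring T V) (x y p q : H) :
    inner ℂ p (T (outer x y) q) = inner ℂ (slice q (V y)) (slice p (V x)) := by
  rw [hV, conjBy_outer]
  exact inner_ptraceLeft_outer _ _ _ _

/-- A purification of the pure state `|q⟩⟨q|` is a product vector, with a first factor that is the
same for all vectors having the right coherences with it. -/
theorem eq_tmul_of_ptraceLeft_outer {a b : E ⊗[ℂ] H} {p q : H} (hq : ‖q‖ = 1)
    (hb : ptraceLeft (outer b b) = outer q q) (hab : ptraceLeft (outer a b) = outer p q)
    (hn : ‖a‖ = ‖p‖) : ‖slice q b‖ = 1 ∧ a = slice q b ⊗ₜ[ℂ] p := by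
  have hqq : inner ℂ q q = (1 : ℂ) := by rw [inner_self_eq_norm_sq_to_K, hq]; simp
  have h1 := inner_ptraceLeft_outer b b q q
  rw [hb, outer_apply, hqq, one_smul, hqq, inner_self_eq_norm_sq_to_K,
    RCLike.ofReal_eq_complex_ofReal] at h1
  have he : ‖slice q b‖ = 1 := by
    have h1' : ‖slice q b‖ ^ 2 = 1 := by exact_mod_cast h1.symm
    nlinarith [norm_nonneg (slice q b)]
  refine ⟨he, ?_⟩
  have h2 := inner_ptraceLeft_outer a b p q
  rw [hab, outer_apply, hqq, one_smul, inner_self_eq_norm_sq_to_K, inner_slice] at h2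
  have h3 : ‖slice q b ⊗ₜ[ℂ] p - a‖ ^ 2 = 0 := by
    rw [norm_sub_sq (𝕜 := ℂ), ← h2, TensorProduct.norm_tmul, he, hn]
    norm_cast; simp; ring
  exact (sub_eq_zero.1 (norm_eq_zero.1 (pow_eq_zero_iff two_ne_zero |>.1 h3))).symm

/-- If the output of a channel on a pure state passes a projective test for `|q⟩⟨q|` with
certainty, then it is `|q⟩⟨q|`. -/
theorem apply_ketbra_eq_of_inner_eq_one {T : SuperOp H H} {V : H →ₗᵢ[ℂ] E ⊗[ℂ] H}
    (hV : IsStinespring T V) {x q : H} (hx : ‖x‖ = 1) (hq : ‖q‖ = 1)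
    (h : (inner ℂ q (T (ketbra x) q)).re = 1) : T (ketbra x) = ketbra q := by
  rw [ketbra, hV.inner_apply_outer, ← RCLike.re_to_complex, inner_self_eq_norm_sq] at h
  have hs : ‖slice q (V x) ⊗ₜ[ℂ] q - V x‖ ^ 2 = 0 := by
    rw [norm_sub_sq (𝕜 := ℂ), ← inner_slice, inner_self_eq_norm_sq, TensorProduct.norm_tmul,
      mul_pow, h, hq, V.norm_map, hx]
    norm_num
  have hs' := sub_eq_zero.1 (norm_eq_zero.1 (pow_eq_zero_iff two_ne_zero |>.1 hs))
  rw [ketbra, hV, conjBy_outer]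
  change ptraceLeft (outer (V x) (V x)) = _
  rw [← hs', ← map_outer, ptraceLeft_map, trace_outer, inner_self_eq_norm_sq_to_K]
  rw [RCLike.ofReal_eq_complex_ofReal, ← Complex.ofReal_pow, h, Complex.ofReal_one, one_smul,
    ketbra]

/-- The compression `(⟨e| ⊗ 1) V` of a Stinespring isometry: the Kraus operator belonging to the
environment vector `e`. -/
def krausOf (V : H →ₗᵢ[ℂ] E ⊗[ℂ] H) (e : E) : Op H :=
  slice e ∘ₗ (TensorProduct.comm ℂ E H).toLinearMap ∘ₗ V.toLinearMap

theorem inner_comm_tmul (y : H) (e : E) (u : E ⊗[ℂ] H) :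
    inner ℂ (y ⊗ₜ[ℂ] e) (TensorProduct.comm ℂ E H u) = inner ℂ (e ⊗ₜ[ℂ] y) u := by
  induction u with
  | zero => simp
  | tmul a b => simp [mul_comm]
  | add a b ha hb => simp [inner_add_right, ha, hb]

theorem inner_krausOf (V : H →ₗᵢ[ℂ] E ⊗[ℂ] H) (e : E) (x y : H) :
    inner ℂ y (krausOf V e x) = inner ℂ (e ⊗ₜ[ℂ] y) (V x) := by
  simp only [krausOf, LinearMap.comp_apply, inner_slice]
  exact inner_comm_tmul _ _ _

theorem norm_krausOf_le (V : H →ₗᵢ[ℂ] E ⊗[ℂ] H) {e : E} (he : ‖e‖ = 1) (x : H) :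
    ‖krausOf V e x‖ ≤ ‖x‖ := by
  have h : ‖krausOf V e x‖ ^ 2 ≤ ‖krausOf V e x‖ * ‖x‖ := by
    rw [← inner_self_eq_norm_sq (𝕜 := ℂ) (krausOf V e x)]
    rw [inner_krausOf]
    refine (re_inner_le_norm (𝕜 := ℂ) (e ⊗ₜ[ℂ] krausOf V e x) (V x)).trans_eq ?_
    rw [TensorProduct.norm_tmul, he, V.norm_map]; ring
  rcases (norm_nonneg (krausOf V e x)).eq_or_lt with h0 | h0
  · rw [← h0]; positivity
  · nlinarith

theorem krausOf_of_eq_tmul {V : H →ₗᵢ[ℂ] E ⊗[ℂ] H} {e : E} (he : ‖e‖ = 1) {x p : H}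
    (h : V x = e ⊗ₜ[ℂ] p) : krausOf V e x = p := by
  have : krausOf V e x = inner ℂ e e • p := by
    simp only [krausOf, LinearMap.comp_apply]
    rw [show V.toLinearMap x = e ⊗ₜ[ℂ] p from h]
    simp [slice_tmul]
  rw [this, inner_self_eq_norm_sq_to_K, he]; simp

/-- A single Kraus operator contributes at most the whole channel to each diagonal element. -/
theorem norm_inner_krausOf_sq_le {T : SuperOp H H} {V : H →ₗᵢ[ℂ] E ⊗[ℂ] H}
    (hV : IsStinespring T V) {e : E} (he : ‖e‖ = 1) (x y : H) :
    ‖inner ℂ y (krausOf V e x)‖ ^ 2 ≤ (inner ℂ y (T (ketbra x) y)).re := by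
  rw [ketbra, hV.inner_apply_outer, ← RCLike.re_to_complex, inner_self_eq_norm_sq, inner_krausOf,
    ← inner_slice]
  have := norm_inner_le_norm (𝕜 := ℂ) e (slice y (V x))
  rw [he, one_mul] at this
  gcongr

theorem envState_of_eq_tmul {V : H →ₗᵢ[ℂ] E ⊗[ℂ] H} {e : E} {v w : H} (hw : ‖w‖ = 1)
    (h : V v = e ⊗ₜ[ℂ] w) : envState V v = outer e e := by
  rw [envState, ketbra, conjBy_outer, LinearIsometry.coe_toLinearMap, h, ← map_outer,
    ptraceRight_map, trace_outer, inner_self_eq_norm_sq_to_K, hw]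
  simp

theorem suppProj_of_eq_tmul {V : H →ₗᵢ[ℂ] E ⊗[ℂ] H} {e : E} {v w : H} (he : ‖e‖ = 1)
    (hw : ‖w‖ = 1) (h : V v = e ⊗ₜ[ℂ] w) : suppProj V v = outer e e := by
  have hker : LinearMap.ker (envState V v) = (Submodule.span ℂ {e})ᗮ := by
    ext x
    have he0 : e ≠ 0 := by rintro rfl; simp at he
    rw [envState_of_eq_tmul hw h, LinearMap.mem_ker, outer_apply, smul_eq_zero_iff_left he0,
      Submodule.mem_orthogonal_singleton_iff_inner_right]
  ext x
  simp only [suppProj, hker, Submodule.orthogonal_orthogonal, outer_apply]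
  exact Submodule.starProjection_unit_singleton ℂ he x

theorem suppProj_add_kerProj (V : H →ₗᵢ[ℂ] E ⊗[ℂ] H) (v : H) :
    suppProj V v + kerProj V v = LinearMap.id := by
  ext x
  simp only [suppProj, kerProj, LinearMap.add_apply, LinearMap.id_apply]
  rw [add_comm]
  exact Submodule.starProjection_add_starProjection_orthogonal _

/-- The interaction functional is the trace lost under `T↓`. -/
theorem interactionFunctional_eq (V : H →ₗᵢ[ℂ] E ⊗[ℂ] H) (v : H) (ρ : Op H) :
    interactionFunctional V v ρ
      = LinearMap.trace ℂ H ρ - LinearMap.trace ℂ H (downOp V v ρ) := by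
  have hiso : LinearMap.adjoint V.toLinearMap ∘ₗ V.toLinearMap = LinearMap.id := by
    ext x
    refine ext_inner_left ℂ fun y => ?_
    simp
  have h1 : LinearMap.trace ℂ H ρ = LinearMap.trace ℂ _ (conjBy V.toLinearMap ρ) := by
    rw [trace_conjBy, hiso, LinearMap.id_comp]
  rw [interactionFunctional, trace_comp_ptraceRight, downOp, LinearMap.comp_apply,
    trace_ptraceLeft, LinearMap.comp_apply, LinearMap.mulLeft_apply, Module.End.mul_eq_comp,
    eq_sub_iff_add_eq, ← map_add, ← LinearMap.add_comp, ← TensorProduct.map_add_left, add_comm,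
    suppProj_add_kerProj, TensorProduct.map_id, LinearMap.id_comp, h1]

/-- If the vacuum leaves the environment in the pure state `e`, then `T↓` has the single Kraus
operator `(⟨e| ⊗ 1) V`. -/
theorem downOp_of_eq_tmul {V : H →ₗᵢ[ℂ] E ⊗[ℂ] H} {e : E} {v w : H} (he : ‖e‖ = 1)
    (hw : ‖w‖ = 1) (h : V v = e ⊗ₜ[ℂ] w) : downOp V v = conjBy (krausOf V e) := by
  refine linearMap_ext_outer fun x y => ?_
  have hP : TensorProduct.map (outer e e) (LinearMap.id : Op H) ∘ₗ outer (V x) (V y)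
      = outer (e ⊗ₜ[ℂ] krausOf V e x) (V y) := by
    have hmap : ∀ u : E ⊗[ℂ] H, TensorProduct.map (outer e e) (LinearMap.id : Op H) u
        = e ⊗ₜ[ℂ] slice e (TensorProduct.comm ℂ E H u) := by
      intro u
      induction u with
      | zero => simp
      | tmul a b => simp [outer_apply, slice_tmul, TensorProduct.smul_tmul]
      | add a b ha hb => simp [ha, hb, TensorProduct.tmul_add]
    refine LinearMap.ext fun z => ?_
    rw [LinearMap.comp_apply, outer_apply, outer_apply, map_smul, hmap]
    rfl
  rw [downOp, LinearMap.comp_apply, LinearMap.comp_apply, LinearMap.mulLeft_apply,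
    Module.End.mul_eq_comp, suppProj_of_eq_tmul he hw h, conjBy_outer, conjBy_outer]
  simp only [LinearIsometry.coe_toLinearMap]
  rw [hP]
  refine LinearMap.ext fun q => ext_inner_left ℂ fun p => ?_
  rw [inner_ptraceLeft_outer, slice_tmul, inner_smul_right, slice_inner, outer_apply,
    inner_smul_right, ← inner_conj_symm (V y), ← inner_krausOf, inner_conj_symm,
    mul_comm]

theorem interactionFunctional_ketbra {V : H →ₗᵢ[ℂ] E ⊗[ℂ] H} {e : E} {v w : H} (he : ‖e‖ = 1)
    (hw : ‖w‖ = 1) (h : V v = e ⊗ₜ[ℂ] w) (x : H) :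
    interactionFunctional V v (ketbra x) = ((‖x‖ ^ 2 - ‖krausOf V e x‖ ^ 2 : ℝ) : ℂ) := by
  rw [interactionFunctional_eq, downOp_of_eq_tmul he hw h, conjBy_ketbra, trace_ketbra,
    trace_ketbra, Complex.ofReal_sub]

end Stinespring

/-! ### Channels that apply a contraction or reset -/

section Channels

set_option linter.unusedSectionVars false

variable {H K Z : Type*}
  [NormedAddCommGroup H] [InnerProductSpace ℂ H] [FiniteDimensional ℂ H]
  [NormedAddCommGroup K] [InnerProductSpace ℂ K] [FiniteDimensional ℂ K]
  [NormedAddCommGroup Z] [InnerProductSpace ℂ Z] [FiniteDimensional ℂ Z]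

theorem conjBy_isPositive (W : H →ₗ[ℂ] K) {X : Op H} (hX : X.IsPositive) :
    (conjBy W X).IsPositive := hX.conj_adjoint W

theorem isCompletelyPositive_conjBy (W : H →ₗ[ℂ] K) : IsCompletelyPositive (conjBy W) := by
  intro k X hX
  rw [ampl_conjBy]
  exact conjBy_isPositive _ hX

theorem ampl_add (S T : SuperOp H K) : ampl Z (S + T) = ampl Z S + ampl Z T :=
  linearMap_ext_map fun A B => by simp [ampl_map, TensorProduct.map_add_left]

theorem IsCompletelyPositive.add {S T : SuperOp H K} (hS : IsCompletelyPositive S)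
    (hT : IsCompletelyPositive T) : IsCompletelyPositive (S + T) := by
  intro k X hX
  rw [ampl_add]
  exact (hS k X hX).add (hT k X hX)

theorem IsCompletelyPositive.sum {ι : Type*} (s : Finset ι) {S : ι → SuperOp H K}
    (hS : ∀ i, IsCompletelyPositive (S i)) : IsCompletelyPositive (∑ i ∈ s, S i) := by
  classical
  induction s using Finset.induction_on with
  | empty =>
    intro k X _
    have : ampl (Cn k) (0 : SuperOp H K) = 0 := linearMap_ext_map fun A B => by simp [ampl_map]
    simp [this]
  | insert i s hi ih => rw [Finset.sum_insert hi]; exact (hS i).add ih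

theorem one_sub_adjoint_comp_self_isPositive {A : H →ₗ[ℂ] K} (hA : ∀ x, ‖A x‖ ≤ ‖x‖) :
    (1 - LinearMap.adjoint A ∘ₗ A : Op H).IsPositive := by
  refine ⟨fun x y => ?_, fun x => ?_⟩
  · simp [inner_sub_left, inner_sub_right, LinearMap.adjoint_inner_left,
      LinearMap.adjoint_inner_right]
  · simp only [LinearMap.sub_apply, Module.End.one_apply, LinearMap.comp_apply, inner_sub_left,
      LinearMap.adjoint_inner_left, map_sub, inner_self_eq_norm_sq, sub_nonneg]
    gcongr
    exact hA x

/-- `X ↦ A X A† + tr((1 - A†A) X) |z⟩⟨z|`: the two-outcome measurement with the Kraus operator `A`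
for one outcome, with a reset to the pure state `z` after the other one. -/
def conjOrReset (A : H →ₗ[ℂ] K) (z : K) : SuperOp H K :=
  conjBy A +
    (LinearMap.trace ℂ H ∘ₗ LinearMap.mulLeft ℂ (1 - LinearMap.adjoint A ∘ₗ A)).smulRight (ketbra z)

/-- The probability `tr((1 - A†A) X)` of a reset under `conjOrReset A z`. -/
def resetProb (A : H →ₗ[ℂ] K) (X : Op H) : ℂ :=
  LinearMap.trace ℂ H X - LinearMap.trace ℂ K (conjBy A X)

theorem conjOrReset_apply (A : H →ₗ[ℂ] K) (z : K) (X : Op H) :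
    conjOrReset A z X = conjBy A X + resetProb A X • ketbra z := by
  simp only [conjOrReset, resetProb, trace_conjBy, LinearMap.add_apply, LinearMap.smulRight_apply,
    LinearMap.comp_apply, LinearMap.mulLeft_apply, sub_mul, one_mul, map_sub]
  rfl

theorem exists_resetProb_eq {A : H →ₗ[ℂ] K} (hA : ∀ x, ‖A x‖ ≤ ‖x‖) :
    ∃ (m : ℕ) (u : Fin m → H), ∀ X : Op H, resetProb A X = ∑ k, inner ℂ (u k) (X (u k)) := by
  obtain ⟨m, u, hu⟩ := exists_sum_outer _ (one_sub_adjoint_comp_self_isPositive hA)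
  refine ⟨m, u, fun X => ?_⟩
  have h : LinearMap.trace ℂ H ((1 - LinearMap.adjoint A ∘ₗ A : Op H) ∘ₗ X) = resetProb A X := by
    rw [resetProb, trace_conjBy, LinearMap.sub_comp, map_sub]
    rfl
  rw [← h, hu, ← Module.End.mul_eq_comp, Finset.sum_mul, map_sum]
  exact Finset.sum_congr rfl fun k _ => trace_outer_comp _ _ _

theorem isChannel_conjOrReset {A : H →ₗ[ℂ] K} (hA : ∀ x, ‖A x‖ ≤ ‖x‖) {z : K} (hz : ‖z‖ = 1) :
    IsChannel (conjOrReset A z) := by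
  obtain ⟨m, u, hu⟩ := exists_resetProb_eq hA
  have h : conjOrReset A z
      = conjBy A + ∑ k, conjBy (InnerProductSpace.rankOne ℂ z (u k)).toLinearMap := by
    ext X : 1
    simp only [conjOrReset_apply, hu, LinearMap.add_apply, LinearMap.sum_apply, conjBy_rankOne,
      Finset.sum_smul]
  refine ⟨?_, fun ρ => ?_⟩
  · rw [h]
    exact (isCompletelyPositive_conjBy A).add
      (IsCompletelyPositive.sum _ fun k => isCompletelyPositive_conjBy _)
  · rw [conjOrReset_apply, map_add, map_smul, trace_ketbra, hz, resetProb]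
    simp

/-- A positive operator is `Φ†Φ` for some `Φ`, stated through the quadratic form. -/
theorem exists_inner_eq_norm_sq {X : Op H} (hX : X.IsPositive) :
    ∃ (m : ℕ) (Φ : H →ₗ[ℂ] Cn m), ∀ y, inner ℂ y (X y) = ((‖Φ y‖ ^ 2 : ℝ) : ℂ) := by
  obtain ⟨m, u, hu⟩ := exists_sum_outer X hX
  let e := EuclideanSpace.basisFun (Fin m) ℂ
  refine ⟨m, ∑ k, (InnerProductSpace.rankOne ℂ (e k) (u k)).toLinearMap, fun y => ?_⟩
  have h : (∑ k, (InnerProductSpace.rankOne ℂ (e k) (u k)).toLinearMap) y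
      = ∑ k, inner ℂ (u k) y • e k := by simp
  rw [h, Complex.ofReal_pow, ← RCLike.ofReal_eq_complex_ofReal, ← inner_self_eq_norm_sq_to_K,
    e.orthonormal.inner_sum, hu]
  simp only [LinearMap.sum_apply, inner_sum, outer_apply, inner_smul_right, inner_conj_symm]
  exact Finset.sum_congr rfl fun k _ => mul_comm _ _

theorem exists_resetProb_eq_ofReal {A : H →ₗ[ℂ] K} (hA : ∀ x, ‖A x‖ ≤ ‖x‖) {X : Op H}
    (hX : X.IsPositive) : ∃ τ : ℝ, 0 ≤ τ ∧ resetProb A X = τ := by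
  obtain ⟨m, u, hu⟩ := exists_resetProb_eq hA
  obtain ⟨l, Φ, hΦ⟩ := exists_inner_eq_norm_sq hX
  refine ⟨∑ k, ‖Φ (u k)‖ ^ 2, Finset.sum_nonneg fun k _ => by positivity, ?_⟩
  rw [hu, Complex.ofReal_sum]
  exact Finset.sum_congr rfl fun k _ => hΦ _

/-- The contraction `|x⟩⟨a| + |y⟩⟨b|`. -/
def transfer (x y : K) (a b : H) : H →ₗ[ℂ] K :=
  (InnerProductSpace.rankOne ℂ x a + InnerProductSpace.rankOne ℂ y b).toLinearMap

theorem transfer_apply (x y : K) (a b ξ : H) :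
    transfer x y a b ξ = inner ℂ a ξ • x + inner ℂ b ξ • y := by simp [transfer]

theorem norm_transfer_apply_le {x y : K} {a b : H} (hxy : Orthonormal ℂ ![x, y])
    (hab : Orthonormal ℂ ![a, b]) (ξ : H) : ‖transfer x y a b ξ‖ ≤ ‖ξ‖ := by
  have h1 := hab.sum_inner_products_le (s := Finset.univ) ξ
  have h2 : ‖transfer x y a b ξ‖ ^ 2 = ‖inner ℂ a ξ‖ ^ 2 + ‖inner ℂ b ξ‖ ^ 2 := by
    have hx : ‖x‖ = 1 := hxy.1 0
    have hy : ‖y‖ = 1 := hxy.1 1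
    have h0 : inner ℂ x y = 0 := hxy.2 (i := 0) (j := 1) (by simp)
    rw [transfer_apply, norm_add_sq (𝕜 := ℂ), inner_smul_left, inner_smul_right, h0, norm_smul,
      norm_smul, hx, hy]
    simp
  rw [Fin.sum_univ_two] at h1
  refine (sq_le_sq₀ (norm_nonneg _) (norm_nonneg _)).1 ?_
  rw [h2]
  exact h1

theorem conjBy_comp_transfer (L : K →ₗ[ℂ] Z) {x y : K} {a b : H} {s c : ℝ} {φ : Z}
    (hx : L x = (s : ℂ) • φ) (hy : L y = (c : ℂ) • φ) (X : Op H) :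
    conjBy L (conjBy (transfer x y a b) X)
      = inner ℂ ((s : ℂ) • a + (c : ℂ) • b) (X ((s : ℂ) • a + (c : ℂ) • b)) • ketbra φ := by
  have h : L ∘ₗ transfer x y a b
      = (InnerProductSpace.rankOne ℂ φ ((s : ℂ) • a + (c : ℂ) • b)).toLinearMap := by
    refine LinearMap.ext fun ξ => ?_
    rw [ContinuousLinearMap.coe_coe, InnerProductSpace.rankOne_apply]
    simp only [LinearMap.comp_apply, transfer_apply, map_add, map_smul, hx, hy, inner_add_left,
      inner_smul_left, add_smul, smul_smul, Complex.conj_ofReal, mul_comm]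
  rw [← conjBy_comp, h, conjBy_rankOne]

theorem trace_conjBy_transfer {x y : K} {a b : H} (hxy : Orthonormal ℂ ![x, y]) (X : Op H) :
    LinearMap.trace ℂ K (conjBy (transfer x y a b) X) = inner ℂ a (X a) + inner ℂ b (X b) := by
  have hx : ‖x‖ = 1 := hxy.1 0
  have hy : ‖y‖ = 1 := hxy.1 1
  have h0 : inner ℂ x y = 0 := hxy.2 (i := 0) (j := 1) (by simp)
  have h0' : inner ℂ y x = 0 := hxy.2 (i := 1) (j := 0) (by simp)
  have h : LinearMap.adjoint (transfer x y a b) ∘ₗ transfer x y a b = outer a a + outer b b := by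
    ext ξ
    refine ext_inner_left ℂ fun η => ?_
    simp [LinearMap.adjoint_inner_right, transfer_apply, outer_apply, inner_add_left,
      inner_add_right, inner_smul_left, inner_smul_right, h0, h0', hx, hy]
  rw [trace_conjBy, h, LinearMap.add_comp, map_add, trace_outer_comp, trace_outer_comp]

end Channels

/-! ### The quantum Zeno strategy -/

section Zeno

set_option linter.unusedSectionVars false

variable {H : Type*} [NormedAddCommGroup H] [InnerProductSpace ℂ H] [FiniteDimensional ℂ H]

/-- The standard basis of the qubit. -/
abbrev qubit : OrthonormalBasis (Fin 2) ℂ (Cn 2) := EuclideanSpace.basisFun (Fin 2) ℂ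

/-- `α v ⊗ |0⟩ + β φ ⊗ |1⟩`. -/
def superpos (α β : ℝ) (v φ : H) : H ⊗[ℂ] Cn 2 :=
  ((α : ℂ) • v) ⊗ₜ[ℂ] qubit 0 + ((β : ℂ) • φ) ⊗ₜ[ℂ] qubit 1

theorem inner_superpos {v φ : H} (hv : ‖v‖ = 1) (hφ : ‖φ‖ = 1) (α β α' β' : ℝ) :
    inner ℂ (superpos α β v φ) (superpos α' β' v φ) = ((α * α' + β * β' : ℝ) : ℂ) := by
  simp only [superpos, inner_add_left, inner_add_right, TensorProduct.inner_tmul,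
    inner_smul_left, inner_smul_right, qubit.inner_eq_ite, inner_self_eq_norm_sq_to_K, hv, hφ]
  simp [mul_comm]

theorem norm_superpos {v φ : H} (hv : ‖v‖ = 1) (hφ : ‖φ‖ = 1) {α β : ℝ} (h : α ^ 2 + β ^ 2 = 1) :
    ‖superpos α β v φ‖ = 1 := by
  have h1 : ‖superpos α β v φ‖ ^ 2 = 1 := by
    rw [← inner_self_eq_norm_sq (𝕜 := ℂ), inner_superpos hv hφ, ← h, RCLike.re_to_complex,
      Complex.ofReal_re]
    ring
  nlinarith [norm_nonneg (superpos α β v φ)]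

theorem orthonormal_superpos {v φ : H} (hv : ‖v‖ = 1) (hφ : ‖φ‖ = 1) {α β α' β' : ℝ}
    (h : α ^ 2 + β ^ 2 = 1) (h' : α' ^ 2 + β' ^ 2 = 1) (h0 : α * α' + β * β' = 0) :
    Orthonormal ℂ ![superpos α β v φ, superpos α' β' v φ] := by
  have h1 : inner ℂ (superpos α β v φ) (superpos α' β' v φ) = 0 := by
    rw [inner_superpos hv hφ, h0, Complex.ofReal_zero]
  have h2 : inner ℂ (superpos α' β' v φ) (superpos α β v φ) = 0 := by
    rw [inner_superpos hv hφ, mul_comm, mul_comm β', h0, Complex.ofReal_zero]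
  refine ⟨fun i => ?_, fun i j hij => ?_⟩
  · fin_cases i
    · exact norm_superpos hv hφ h
    · exact norm_superpos hv hφ h'
  · fin_cases i <;> fin_cases j
    · exact absurd rfl hij
    · exact h1
    · exact h2
    · exact absurd rfl hij

theorem slice_zero_superpos (α β : ℝ) (v φ : H) :
    slice (qubit 0) (superpos α β v φ) = (α : ℂ) • v := by
  simp only [superpos, map_add, slice_tmul, qubit.inner_eq_ite]
  simp

theorem slice_one_superpos (α β : ℝ) (v φ : H) :
    slice (qubit 1) (superpos α β v φ) = (β : ℂ) • φ := by
  simp only [superpos, map_add, slice_tmul, qubit.inner_eq_ite]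
  simp

theorem superpos_eq_smul_add (α β : ℝ) (v φ : H) :
    superpos α β v φ = (α : ℂ) • superpos 1 0 v φ + (β : ℂ) • superpos 0 1 v φ := by
  simp only [superpos, Complex.ofReal_one, Complex.ofReal_zero, one_smul, zero_smul,
    TensorProduct.zero_tmul, add_zero, zero_add, TensorProduct.smul_tmul']

/-- A super-operator acting on the four operators `|v⟩⟨v|, |v⟩⟨φ|, |φ⟩⟨v|, |φ⟩⟨φ|` as an isometry
with `v ↦ w`, `φ ↦ χ` acts on superpositions coherently. -/
theorem ampl_ketbra_superpos {T : SuperOp H H} {v φ w χ : H}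
    (h00 : T (outer v v) = outer w w) (h01 : T (outer v φ) = outer w χ)
    (h10 : T (outer φ v) = outer χ w) (h11 : T (outer φ φ) = outer χ χ) (α β : ℝ) :
    ampl (Cn 2) T (ketbra (superpos α β v φ)) = ketbra (superpos α β w χ) := by
  have key : ∀ x y : H, ketbra (superpos α β x y)
      = ((α * α : ℝ) : ℂ) • TensorProduct.map (outer x x) (outer (qubit 0) (qubit 0))
      + ((α * β : ℝ) : ℂ) • TensorProduct.map (outer x y) (outer (qubit 0) (qubit 1))
      + ((β * α : ℝ) : ℂ) • TensorProduct.map (outer y x) (outer (qubit 1) (qubit 0))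
      + ((β * β : ℝ) : ℂ) • TensorProduct.map (outer y y) (outer (qubit 1) (qubit 1)) := by
    intro x y
    have hs : ∀ (a b : ℝ) (x y : H) (i j : Fin 2),
        ((a * b : ℝ) : ℂ) • TensorProduct.map (outer x y) (outer (qubit i) (qubit j))
          = outer (((a : ℂ) • x) ⊗ₜ[ℂ] qubit i) (((b : ℂ) • y) ⊗ₜ[ℂ] qubit j) := by
      intro a b x y i j
      rw [← map_outer, ← TensorProduct.map_smul_left]
      congr 1
      ext z
      simp only [outer_apply, LinearMap.smul_apply, inner_smul_left, Complex.conj_ofReal, smul_smul,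
        Complex.ofReal_mul]
      congr 1
      ring
    simp only [hs]
    refine LinearMap.ext fun z => ?_
    simp only [ketbra, superpos, outer_apply, LinearMap.add_apply, inner_add_left]
    module
  simp only [key, map_add, map_smul, ampl_map, h00, h01, h10, h11]

/-- One correction step: the plane spanned by `w ⊗ |0⟩` and `χ ⊗ |1⟩` is mapped to the plane
spanned by `v ⊗ |0⟩` and `φ ⊗ |1⟩` and rotated by `θ`; a state found outside of the former plane is
reset to the rotated vacuum. -/
def zenoStep (θ : ℝ) (v w φ χ : H) : SuperOp (H ⊗[ℂ] Cn 2) (H ⊗[ℂ] Cn 2) :=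
  conjOrReset
    (transfer (superpos (Real.cos θ) (Real.sin θ) v φ) (superpos (-Real.sin θ) (Real.cos θ) v φ)
      (superpos 1 0 w χ) (superpos 0 1 w χ))
    (superpos (Real.cos θ) (Real.sin θ) v φ)

theorem orthonormal_rotated (θ : ℝ) {v φ : H} (hv : ‖v‖ = 1) (hφ : ‖φ‖ = 1) :
    Orthonormal ℂ ![superpos (Real.cos θ) (Real.sin θ) v φ,
      superpos (-Real.sin θ) (Real.cos θ) v φ] :=
  orthonormal_superpos hv hφ (Real.cos_sq_add_sin_sq θ) (by simp) (by ring)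

theorem orthonormal_unrotated {w χ : H} (hw : ‖w‖ = 1) (hχ : ‖χ‖ = 1) :
    Orthonormal ℂ ![superpos 1 0 w χ, superpos 0 1 w χ] :=
  orthonormal_superpos hw hχ (by simp) (by simp) (by simp)

/-- The final measurement of `|χ⟩⟨χ| ⊗ |1⟩⟨1|`, the outcome being written on a qubit. -/
def zenoReadout (w χ : H) : SuperOp (H ⊗[ℂ] Cn 2) (Cn 2) :=
  conjOrReset (InnerProductSpace.rankOne ℂ (qubit 0) (superpos 0 1 w χ)).toLinearMap (qubit 1)

theorem norm_rankOne_superpos_le {w χ : H} (hw : ‖w‖ = 1) (hχ : ‖χ‖ = 1) (ξ : H ⊗[ℂ] Cn 2) :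
    ‖(InnerProductSpace.rankOne ℂ (qubit 0) (superpos 0 1 w χ)).toLinearMap ξ‖ ≤ ‖ξ‖ := by
  rw [ContinuousLinearMap.coe_coe, InnerProductSpace.rankOne_apply, norm_smul, qubit.norm_eq_one,
    mul_one]
  refine (norm_inner_le_norm _ _).trans ?_
  rw [norm_superpos hw hχ (by simp), one_mul]

/-- The quantum Zeno strategy. The `n`-th call of the channel is tested with the vector `φ n`
against the vacuum `v`, in superposition controlled by the ancillary qubit; `w` and `χ n` are the
images of `v` and `φ n` under the isometric hypothesis. -/
def zeno (N : ℕ) (θ : ℝ) (v w : H) (φ χ : ℕ → H) (hv : ‖v‖ = 1) (hw : ‖w‖ = 1)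
    (hφ : ∀ n, ‖φ n‖ = 1) (hχ : ∀ n, ‖χ n‖ = 1) : Strategy N H (Cn 2) (Cn 1) (Cn 2) where
  init := ketbra (EuclideanSpace.basisFun (Fin 1) ℂ 0)
  first := conjOrReset 0 (superpos (Real.cos θ) (Real.sin θ) v (φ 0))
  mid n := zenoStep θ v w (φ n) (χ (n - 1))
  last := zenoReadout w (χ (N - 1))
  init_isState := by
    refine ⟨outer_self_isPositive _, ?_⟩
    rw [trace_ketbra, OrthonormalBasis.norm_eq_one]
    simp
  first_isChannel := isChannel_conjOrReset (by simp)
    (norm_superpos hv (hφ 0) (Real.cos_sq_add_sin_sq θ))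
  mid_isChannel n _ _ := isChannel_conjOrReset
    (norm_transfer_apply_le (orthonormal_rotated θ hv (hφ n)) (orthonormal_unrotated hw (hχ _)))
    (norm_superpos hv (hφ n) (Real.cos_sq_add_sin_sq θ))
  last_isChannel := isChannel_conjOrReset (norm_rankOne_superpos_le hw (hχ _))
    (qubit.norm_eq_one 1)

/-- The measurement of the outcome qubit. -/
def readoutPOVM : POVM2 (Cn 2) where
  πA := ketbra (qubit 0)
  πB := ketbra (qubit 1)
  πA_pos := outer_self_isPositive _
  πB_pos := outer_self_isPositive _
  add_eq_one := by
    refine LinearMap.ext fun z => ?_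
    have := qubit.sum_repr' z
    rw [Fin.sum_univ_two] at this
    simpa [ketbra, outer_apply] using this

end Zeno

section ZenoAnalysis

set_option linter.unusedSectionVars false

variable {H : Type*} [NormedAddCommGroup H] [InnerProductSpace ℂ H] [FiniteDimensional ℂ H]

/-! ### The strategy on an isometric channel -/

theorem zenoStep_ketbra (θ η : ℝ) {v w φ χ : H} (hv : ‖v‖ = 1) (hw : ‖w‖ = 1) (hφ : ‖φ‖ = 1)
    (hχ : ‖χ‖ = 1) :
    zenoStep θ v w φ χ (ketbra (superpos (Real.cos η) (Real.sin η) w χ))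
      = ketbra (superpos (Real.cos (η + θ)) (Real.sin (η + θ)) v φ) := by
  have hA : transfer (superpos (Real.cos θ) (Real.sin θ) v φ)
      (superpos (-Real.sin θ) (Real.cos θ) v φ) (superpos 1 0 w χ) (superpos 0 1 w χ)
      (superpos (Real.cos η) (Real.sin η) w χ)
        = superpos (Real.cos (η + θ)) (Real.sin (η + θ)) v φ := by
    rw [transfer_apply, inner_superpos hw hχ, inner_superpos hw hχ, superpos_eq_smul_add _ _ v φ,
      superpos_eq_smul_add _ (Real.cos θ) v φ, superpos_eq_smul_add (Real.cos (η + θ)) _ v φ,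
      Real.cos_add, Real.sin_add]
    push_cast
    module
  rw [zenoStep, conjOrReset_apply, resetProb, conjBy_ketbra, hA, trace_ketbra, trace_ketbra,
    norm_superpos hw hχ (Real.cos_sq_add_sin_sq η), norm_superpos hv hφ (Real.cos_sq_add_sin_sq _)]
  simp

variable {N : ℕ} {θ : ℝ} {v w : H} {φ χ : ℕ → H} {hv : ‖v‖ = 1} {hw : ‖w‖ = 1}
  {hφ : ∀ n, ‖φ n‖ = 1} {hχ : ∀ n, ‖χ n‖ = 1}

theorem zeno_state_zero (T : SuperOp H H) :
    (zeno N θ v w φ χ hv hw hφ hχ).state T 0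
      = ketbra (superpos (Real.cos θ) (Real.sin θ) v (φ 0)) := by
  simp only [Strategy.state, zeno, conjOrReset_apply, resetProb]
  have h0 : ∀ X, conjBy (0 : Cn 1 →ₗ[ℂ] H ⊗[ℂ] Cn 2) X = 0 := fun X => by
    rw [conjBy_apply, LinearMap.zero_comp]
  have h1 : ‖EuclideanSpace.basisFun (Fin 1) ℂ 0‖ = 1 := OrthonormalBasis.norm_eq_one _ _
  rw [h0, trace_ketbra, h1]
  simp

theorem zeno_state_succ (T : SuperOp H H) (n : ℕ) :
    (zeno N θ v w φ χ hv hw hφ hχ).state T (n + 1)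
      = zenoStep θ v w (φ (n + 1)) (χ n)
          (ampl (Cn 2) T ((zeno N θ v w φ χ hv hw hφ hχ).state T n)) := rfl

theorem zeno_state_of_isometric {T : SuperOp H H} (h00 : T (outer v v) = outer w w)
    (h01 : ∀ n, T (outer v (φ n)) = outer w (χ n)) (h10 : ∀ n, T (outer (φ n) v) = outer (χ n) w)
    (h11 : ∀ n, T (outer (φ n) (φ n)) = outer (χ n) (χ n)) (n : ℕ) :
    (zeno N θ v w φ χ hv hw hφ hχ).state T n
      = ketbra (superpos (Real.cos ((n + 1) * θ)) (Real.sin ((n + 1) * θ)) v (φ n)) := by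
  induction n with
  | zero => rw [zeno_state_zero]; simp
  | succ n ih =>
    rw [zeno_state_succ, ih, ampl_ketbra_superpos h00 (h01 n) (h10 n) (h11 n),
      zenoStep_ketbra _ _ hv hw (hφ _) (hχ _)]
    push_cast
    rw [show ((n : ℝ) + 1) * θ + θ = (n + 1 + 1) * θ by ring]

theorem trace_πA_zeno_output (T : SuperOp H H) :
    LinearMap.trace ℂ _ (readoutPOVM.πA ∘ₗ (zeno N θ v w φ χ hv hw hφ hχ).output T)
      = inner ℂ (superpos 0 1 w (χ (N - 1))) (ampl (Cn 2) T
          ((zeno N θ v w φ χ hv hw hφ hχ).state T (N - 1)) (superpos 0 1 w (χ (N - 1)))) := by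
  have h : (zeno N θ v w φ χ hv hw hφ hχ).output T = zenoReadout w (χ (N - 1))
      (ampl (Cn 2) T ((zeno N θ v w φ χ hv hw hφ hχ).state T (N - 1))) := rfl
  rw [h]
  change LinearMap.trace ℂ _ (outer (qubit 0) (qubit 0) ∘ₗ _) = _
  rw [trace_outer_comp, zenoReadout, conjOrReset_apply, conjBy_rankOne]
  simp only [LinearMap.add_apply, LinearMap.smul_apply, ketbra, outer_apply, inner_add_right,
    inner_smul_right, qubit.inner_eq_ite]
  simp

theorem trace_πB_zeno_output (T : SuperOp H H) :
    LinearMap.trace ℂ _ (readoutPOVM.πB ∘ₗ (zeno N θ v w φ χ hv hw hφ hχ).output T)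
      = LinearMap.trace ℂ _ (ampl (Cn 2) T ((zeno N θ v w φ χ hv hw hφ hχ).state T (N - 1)))
        - inner ℂ (superpos 0 1 w (χ (N - 1))) (ampl (Cn 2) T
          ((zeno N θ v w φ χ hv hw hφ hχ).state T (N - 1)) (superpos 0 1 w (χ (N - 1)))) := by
  have h : (zeno N θ v w φ χ hv hw hφ hχ).output T = zenoReadout w (χ (N - 1))
      (ampl (Cn 2) T ((zeno N θ v w φ χ hv hw hφ hχ).state T (N - 1))) := rfl
  rw [h]
  change LinearMap.trace ℂ _ (outer (qubit 1) (qubit 1) ∘ₗ _) = _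
  rw [trace_outer_comp, zenoReadout, conjOrReset_apply, resetProb,
    conjBy_rankOne, map_smul, trace_ketbra, qubit.norm_eq_one]
  simp only [LinearMap.add_apply, LinearMap.smul_apply, ketbra, outer_apply, inner_add_right,
    inner_smul_right, qubit.inner_eq_ite]
  simp

/-- An isometric channel turns the vacuum into the test vector by a rotation by `π / 2`, so that it
is recognized with certainty. -/
theorem trace_πB_zeno_output_of_isometric (hN : 1 ≤ N) (hθ : N * θ = Real.pi / 2)
    {T : SuperOp H H} (h00 : T (outer v v) = outer w w)
    (h01 : ∀ n, T (outer v (φ n)) = outer w (χ n)) (h10 : ∀ n, T (outer (φ n) v) = outer (χ n) w)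
    (h11 : ∀ n, T (outer (φ n) (φ n)) = outer (χ n) (χ n)) :
    LinearMap.trace ℂ _ (readoutPOVM.πB ∘ₗ (zeno N θ v w φ χ hv hw hφ hχ).output T) = 0 := by
  have hN' : ((N - 1 : ℕ) : ℝ) + 1 = N := by exact_mod_cast Nat.sub_add_cancel hN
  have hb := norm_superpos (α := 0) (β := 1) hw (hχ (N - 1)) (by simp)
  rw [trace_πB_zeno_output, zeno_state_of_isometric h00 h01 h10 h11,
    ampl_ketbra_superpos h00 (h01 _) (h10 _) (h11 _), hN', hθ, Real.cos_pi_div_two,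
    Real.sin_pi_div_two, trace_ketbra, hb, ketbra, outer_apply, inner_superpos hw (hχ _)]
  simp [inner_superpos hw (hχ _)]

/-! ### The strategy on a general channel -/

theorem ketbra_smul (s : ℝ) (x : H) : ketbra ((s : ℂ) • x) = ((s ^ 2 : ℝ) : ℂ) • ketbra x := by
  refine LinearMap.ext fun z => ?_
  simp only [ketbra, outer_apply, LinearMap.smul_apply, inner_smul_left, Complex.conj_ofReal,
    smul_smul, sq, Complex.ofReal_mul]
  congr 1
  ring

/-- The diagonal blocks of `ρ` with respect to the ancillary qubit are `q |v⟩⟨v|` and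
`p |φ⟩⟨φ|`. -/
structure HasPopulations (ρ : Op (H ⊗[ℂ] Cn 2)) (v φ : H) (q p : ℝ) : Prop where
  isPositive : ρ.IsPositive
  nonneg_zero : 0 ≤ q
  nonneg_one : 0 ≤ p
  add_le_one : q + p ≤ 1
  block_zero : conjBy (slice (qubit 0)) ρ = (q : ℂ) • ketbra v
  block_one : conjBy (slice (qubit 1)) ρ = (p : ℂ) • ketbra φ

theorem HasPopulations.ptraceRight_eq {ρ : Op (H ⊗[ℂ] Cn 2)} {v φ : H} {q p : ℝ}
    (h : HasPopulations ρ v φ q p) :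
    ptraceRight ρ = (q : ℂ) • ketbra v + (p : ℂ) • ketbra φ := by
  rw [ptraceRight_eq_sum_conjBy_slice qubit, Fin.sum_univ_two, h.block_zero, h.block_one]

theorem inner_superpos_zero_one (v φ : H) (X : Op (H ⊗[ℂ] Cn 2)) :
    inner ℂ (superpos 0 1 v φ) (X (superpos 0 1 v φ))
      = inner ℂ φ (conjBy (slice (qubit 1)) X φ) := by
  rw [← inner_tmul_apply_tmul]
  simp [superpos]

theorem conjOrReset_isPositive {K L : Type*}
    [NormedAddCommGroup K] [InnerProductSpace ℂ K] [FiniteDimensional ℂ K]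
    [NormedAddCommGroup L] [InnerProductSpace ℂ L] [FiniteDimensional ℂ L]
    {A : K →ₗ[ℂ] L} (hA : ∀ x, ‖A x‖ ≤ ‖x‖) (z : L) {X : Op K} (hX : X.IsPositive) :
    (conjOrReset A z X).IsPositive := by
  obtain ⟨τ, hτ0, hτ⟩ := exists_resetProb_eq_ofReal hA hX
  rw [conjOrReset_apply, hτ]
  refine (conjBy_isPositive _ hX).add ((outer_self_isPositive z).smul_of_nonneg ?_)
  exact Complex.zero_le_real.2 hτ0

/-- The amplitude `√p` of the excited block grows by at most `|sin θ|` in a step; `l` is the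
population of the tested vector `χ ⊗ |1⟩` before it. -/
theorem zenoStep_hasPopulations (θ : ℝ) {v w φ χ : H} (hv : ‖v‖ = 1) (hw : ‖w‖ = 1)
    (hφ : ‖φ‖ = 1) (hχ : ‖χ‖ = 1) {X : Op (H ⊗[ℂ] Cn 2)} (hX : X.IsPositive) {t l : ℝ}
    (ht : LinearMap.trace ℂ _ X = t) (ht1 : t ≤ 1)
    (hl : inner ℂ (superpos 0 1 w χ) (X (superpos 0 1 w χ)) = (l : ℂ)) :
    ∃ q p : ℝ, HasPopulations (zenoStep θ v w φ χ X) v φ q p ∧ √p ≤ √l + |Real.sin θ| := by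
  have hxy := orthonormal_rotated θ hv hφ
  have hab := orthonormal_unrotated hw hχ
  have hA := norm_transfer_apply_le hxy hab
  obtain ⟨τ, hτ0, hτ⟩ := exists_resetProb_eq_ofReal hA hX
  obtain ⟨k, Φ, hΦ⟩ := exists_inner_eq_norm_sq hX
  have hl' : l = ‖Φ (superpos 0 1 w χ)‖ ^ 2 := by
    rw [hΦ] at hl; exact_mod_cast hl.symm
  have hsum : t = ‖Φ (superpos 1 0 w χ)‖ ^ 2 + l + τ := by
    have := hτ
    rw [resetProb, trace_conjBy_transfer hxy, ht, hΦ, hΦ, ← hl'] at this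
    have h2 : (t : ℂ) = ((‖Φ (superpos 1 0 w χ)‖ ^ 2 + l + τ : ℝ) : ℂ) := by
      push_cast
      push_cast at this
      linear_combination this
    exact_mod_cast h2
  have hblock : ∀ (i : Fin 2) (s c : ℝ) (f : H),
      slice (qubit i) (superpos (Real.cos θ) (Real.sin θ) v φ) = (s : ℂ) • f →
      slice (qubit i) (superpos (-Real.sin θ) (Real.cos θ) v φ) = (c : ℂ) • f →
      conjBy (slice (qubit i)) (zenoStep θ v w φ χ X)
        = ((‖Φ (superpos s c w χ)‖ ^ 2 + s ^ 2 * τ : ℝ) : ℂ) • ketbra f := by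
    intro i s c f hs hc
    rw [zenoStep, conjOrReset_apply, hτ, map_add, map_smul, conjBy_comp_transfer _ hs hc, hΦ,
      conjBy_ketbra, hs, ketbra_smul, smul_smul, ← add_smul, superpos_eq_smul_add s c]
    push_cast
    rw [mul_comm (τ : ℂ)]
  have h0 := hblock 0 _ _ v (slice_zero_superpos _ _ _ _) (slice_zero_superpos _ _ _ _)
  have h1 := hblock 1 _ _ φ (slice_one_superpos _ _ _ _) (slice_one_superpos _ _ _ _)
  refine ⟨_, _, ⟨conjOrReset_isPositive hA _ hX, by positivity, by positivity, ?_, h0, h1⟩, ?_⟩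
  · have htr : LinearMap.trace ℂ _ (zenoStep θ v w φ χ X) = t := by
      rw [← ht]
      exact (isChannel_conjOrReset hA
        (norm_superpos hv hφ (Real.cos_sq_add_sin_sq θ))).2 X
    rw [← trace_ptraceRight, ptraceRight_eq_sum_conjBy_slice qubit, Fin.sum_univ_two, h0, h1,
      map_add, map_smul, map_smul, trace_ketbra, trace_ketbra, hv, hφ] at htr
    refine le_of_eq_of_le ?_ ht1
    rw [one_pow, Complex.ofReal_one, smul_eq_mul, smul_eq_mul, mul_one, mul_one] at htr
    exact_mod_cast htr
  · set m := ‖Φ (superpos 1 0 w χ)‖ with hm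
    set a := ‖Φ (superpos 0 1 w χ)‖ with ha
    have hm0 : 0 ≤ m := norm_nonneg _
    have ha0 : 0 ≤ a := norm_nonneg _
    have hla : √l = a := by rw [hl', Real.sqrt_sq ha0]
    have hs0 : 0 ≤ |Real.sin θ| := abs_nonneg _
    have hs2 : |Real.sin θ| ^ 2 = Real.sin θ ^ 2 := sq_abs _
    have hc1 : |Real.cos θ| ≤ 1 := Real.abs_cos_le_one θ
    have hm1 : m ^ 2 + τ ≤ 1 := by nlinarith
    have hm1' : m ≤ 1 := by nlinarith
    have hΦle : ‖Φ (superpos (Real.sin θ) (Real.cos θ) w χ)‖ ≤ |Real.sin θ| * m + a := by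
      rw [superpos_eq_smul_add, map_add, map_smul, map_smul]
      refine (norm_add_le _ _).trans ?_
      rw [norm_smul, norm_smul, Complex.norm_real, Complex.norm_real, Real.norm_eq_abs,
        Real.norm_eq_abs]
      nlinarith
    refine Real.sqrt_le_iff.2 ⟨by positivity, ?_⟩
    rw [hla]
    have h2 : ‖Φ (superpos (Real.sin θ) (Real.cos θ) w χ)‖ ^ 2 ≤ (|Real.sin θ| * m + a) ^ 2 := by
      gcongr
    have h3 : |Real.sin θ| * m * a ≤ |Real.sin θ| * a := by
      have := mul_le_mul_of_nonneg_left hm1' (mul_nonneg hs0 ha0)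
      linarith
    have h4 : |Real.sin θ| ^ 2 * (m ^ 2 + τ) ≤ |Real.sin θ| ^ 2 * 1 := by gcongr
    rw [← hs2]
    nlinarith

/-- The hypotheses on a super-operator that the Zeno estimate uses; they hold for channels and for
the quantum operations `T↓`. -/
structure IsQuantumOperation (S : SuperOp H H) : Prop where
  isCompletelyPositive : IsCompletelyPositive S
  trace_le : ∀ x : H, ‖x‖ = 1 → ∃ t : ℝ, 0 ≤ t ∧ t ≤ 1 ∧ LinearMap.trace ℂ H (S (ketbra x)) = t

theorem HasPopulations.inner_ampl {ρ : Op (H ⊗[ℂ] Cn 2)} {v φ : H} {q p : ℝ}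
    (h : HasPopulations ρ v φ q p) (S : SuperOp H H) (w χ : H) :
    inner ℂ (superpos 0 1 w χ) (ampl (Cn 2) S ρ (superpos 0 1 w χ))
      = p * inner ℂ χ (S (ketbra φ) χ) := by
  rw [inner_superpos_zero_one, conjBy_slice_ampl, h.block_one, map_smul, LinearMap.smul_apply,
    inner_smul_right]

theorem HasPopulations.zenoStep_ampl {S : SuperOp H H} (hS : IsQuantumOperation S)
    {ρ : Op (H ⊗[ℂ] Cn 2)} {q p : ℝ} {v w φ φ' χ : H} (h : HasPopulations ρ v φ q p)
    (hv : ‖v‖ = 1) (hw : ‖w‖ = 1) (hφ : ‖φ‖ = 1) (hφ' : ‖φ'‖ = 1) (hχ : ‖χ‖ = 1) (θ : ℝ) :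
    ∃ q' p' : ℝ, HasPopulations (zenoStep θ v w φ' χ (ampl (Cn 2) S ρ)) v φ' q' p' ∧
      √p' ≤ √(inner ℂ χ (S (ketbra φ) χ)).re * √p + |Real.sin θ| := by
  have hX := hS.isCompletelyPositive 2 ρ h.isPositive
  obtain ⟨t₀, h₀, h₀', ht₀⟩ := hS.trace_le v hv
  obtain ⟨t₁, h₁, h₁', ht₁⟩ := hS.trace_le φ hφ
  have ht : LinearMap.trace ℂ _ (ampl (Cn 2) S ρ) = ((q * t₀ + p * t₁ : ℝ) : ℂ) := by
    rw [trace_ampl, h.ptraceRight_eq]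
    simp only [map_add, map_smul, ht₀, ht₁, smul_eq_mul]
    push_cast
    rfl
  have hle : q * t₀ + p * t₁ ≤ 1 := by
    have := h.add_le_one
    nlinarith [h.nonneg_zero, h.nonneg_one]
  obtain ⟨m, Φ, hΦ⟩ := exists_inner_eq_norm_sq hX
  have hl := hΦ (superpos 0 1 w χ)
  obtain ⟨q', p', hpop, hle'⟩ := zenoStep_hasPopulations θ hv hw hφ' hχ hX ht hle hl
  refine ⟨q', p', hpop, hle'.trans_eq ?_⟩
  rw [h.inner_ampl] at hl
  have := congrArg Complex.re hl
  rw [Complex.re_ofReal_mul, Complex.ofReal_re] at this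
  rw [← this, mul_comm p, Real.sqrt_mul' _ h.nonneg_one]

theorem exists_zeno_populations (N : ℕ) (θ : ℝ) (hv : ‖v‖ = 1) (hw : ‖w‖ = 1)
    (hφ : ∀ n, ‖φ n‖ = 1) (hχ : ∀ n, ‖χ n‖ = 1) {S : SuperOp H H} (hS : IsQuantumOperation S) :
    ∃ q p : ℕ → ℝ,
      (∀ n, HasPopulations ((zeno N θ v w φ χ hv hw hφ hχ).state S n) v (φ n) (q n) (p n)) ∧
      √(p 0) ≤ |Real.sin θ| ∧
      ∀ n, √(p (n + 1))
        ≤ √(inner ℂ (χ n) (S (ketbra (φ n)) (χ n))).re * √(p n) + |Real.sin θ| := by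
  let D := zeno N θ v w φ χ hv hw hφ hχ
  have h0 : HasPopulations (D.state S 0) v (φ 0) (Real.cos θ ^ 2) (Real.sin θ ^ 2) := by
    have h : D.state S 0 = ketbra (superpos (Real.cos θ) (Real.sin θ) v (φ 0)) := zeno_state_zero S
    rw [h]
    refine ⟨outer_self_isPositive _, by positivity, by positivity,
      (Real.cos_sq_add_sin_sq θ).le, ?_, ?_⟩
    · rw [conjBy_ketbra, slice_zero_superpos, ketbra_smul]
    · rw [conjBy_ketbra, slice_one_superpos, ketbra_smul]
  have hstep := fun (n : ℕ) (q p : ℝ) (h : HasPopulations (D.state S n) v (φ n) q p) =>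
    h.zenoStep_ampl hS hv hw (hφ n) (hφ (n + 1)) (hχ n) θ
  choose f g hf hg using hstep
  -- The populations are built along the recursion, together with the proof that they are such.
  let s : (n : ℕ) → {x : ℝ × ℝ // HasPopulations (D.state S n) v (φ n) x.1 x.2} := fun n =>
    Nat.rec ⟨(_, _), h0⟩ (fun n x => ⟨(f n _ _ x.2, g n _ _ x.2), hf n _ _ x.2⟩) n
  refine ⟨fun n => (s n).1.1, fun n => (s n).1.2, fun n => (s n).2, ?_, fun n => ?_⟩
  · exact (Real.sqrt_sq_eq_abs _).le
  · exact hg n _ _ (s n).2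

end ZenoAnalysis

section Estimates

set_option linter.unusedSectionVars false

variable {H : Type*} [NormedAddCommGroup H] [InnerProductSpace ℂ H] [FiniteDimensional ℂ H]

/-! ### A recursive inequality -/

/-- A quantity that grows by at most `ε` in every step, and is damped by a factor `κ₀ < 1` at least
once in `L` consecutive steps, stays of order `ε`. -/
theorem le_of_damped_recursion {t κ : ℕ → ℝ} {ε κ₀ : ℝ} {L : ℕ} (hε : 0 ≤ ε) (ht : ∀ n, 0 ≤ t n)
    (h0 : t 0 ≤ ε) (hs : ∀ n, t (n + 1) ≤ κ n * t n + ε) (hκ : ∀ n, κ n ≤ 1) (hκ₀ : 0 ≤ κ₀)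
    (hκ₁ : κ₀ < 1) (hL : ∀ n, ∃ k < L, κ (n + k) ≤ κ₀) (n : ℕ) : t n ≤ L / (1 - κ₀) * ε := by
  have hd : 0 < 1 - κ₀ := by linarith
  have hgrow : ∀ n k, t (n + k) ≤ t n + k * ε := by
    intro n k
    induction k with
    | zero => simp
    | succ k ih =>
      have h1 := hs (n + k)
      have h2 := mul_le_mul_of_nonneg_right (hκ (n + k)) (ht (n + k))
      push_cast
      rw [← add_assoc]
      linarith
  have hwindow : ∀ n, t (n + L) ≤ κ₀ * t n + L * ε := by
    intro n
    obtain ⟨k, hk, hkκ⟩ := hL n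
    have h1 := hgrow n k
    have h2 := hs (n + k)
    have h3 := hgrow (n + k + 1) (L - (k + 1))
    rw [show n + k + 1 + (L - (k + 1)) = n + L by omega, Nat.cast_sub (by omega)] at h3
    have h4 := mul_le_mul_of_nonneg_right hkκ (ht (n + k))
    have h5 := mul_le_mul_of_nonneg_left h1 hκ₀
    have h6 : κ₀ * (k * ε) ≤ k * ε :=
      mul_le_of_le_one_left (by positivity) hκ₁.le
    push_cast at h3
    linarith
  have hfix : κ₀ * (L / (1 - κ₀) * ε) + L * ε = L / (1 - κ₀) * ε := by field_simp; ring
  induction n using Nat.strong_induction_on with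
  | _ n ih =>
    rcases lt_or_ge n L with hn | hn
    · have h1 := hgrow 0 n
      rw [zero_add] at h1
      have h2 : (n : ℝ) + 1 ≤ L := by exact_mod_cast hn
      have h3 : (L : ℝ) ≤ L / (1 - κ₀) := le_div_self (Nat.cast_nonneg L) hd (by linarith)
      have h4 := mul_le_mul_of_nonneg_right (h2.trans h3) hε
      linarith
    · have hL0 : 0 < L := by
        obtain ⟨k, hk, -⟩ := hL 0
        omega
      have h1 := hwindow (n - L)
      rw [Nat.sub_add_cancel hn] at h1
      have h2 := mul_le_mul_of_nonneg_left (ih (n - L) (by omega)) hκ₀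
      linarith

/-! ### Channels as quantum operations -/

theorem IsChannel.isQuantumOperation {T : SuperOp H H} (hT : IsChannel T) :
    IsQuantumOperation T :=
  ⟨hT.1, fun x hx => ⟨1, zero_le_one, le_rfl, by rw [hT.2, trace_ketbra, hx]; simp⟩⟩

theorem isQuantumOperation_conjBy {K : Op H} (hK : ∀ x, ‖K x‖ ≤ ‖x‖) :
    IsQuantumOperation (conjBy K) := by
  refine ⟨isCompletelyPositive_conjBy K, fun x hx => ⟨‖K x‖ ^ 2, by positivity, ?_, ?_⟩⟩
  · exact pow_le_one₀ (norm_nonneg _) (hx ▸ hK x)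
  · rw [conjBy_ketbra, trace_ketbra]

theorem norm_inner_apply_outer_le {T : SuperOp H H} (hT : IsChannel T) (x y p q : H) :
    ‖inner ℂ p (T (outer x y) q)‖ ≤ ‖x‖ * ‖y‖ * ‖p‖ * ‖q‖ := by
  obtain ⟨m, V, hV⟩ := hT.exists_isStinespring
  rw [hV.inner_apply_outer]
  refine (norm_inner_le_norm _ _).trans ?_
  refine (mul_le_mul (norm_slice_le q (V y)) (norm_slice_le p (V x)) (norm_nonneg _)
    (by positivity)).trans_eq ?_
  rw [V.norm_map, V.norm_map]
  ring

theorem re_inner_apply_ketbra_le_one {T : SuperOp H H} (hT : IsChannel T) {x p : H} (hx : ‖x‖ = 1)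
    (hp : ‖p‖ = 1) : (inner ℂ p (T (ketbra x) p)).re ≤ 1 := by
  refine (Complex.re_le_norm _).trans ((norm_inner_apply_outer_le hT x x p p).trans_eq ?_)
  rw [hx, hp]
  norm_num

/-! ### Compactness of closed sets of channels -/

theorem isCompact_of_isClosed_of_isChannel {C : Set (SuperOp H H)}
    (hC : IsClosed[moduleTopology ℂ (SuperOp H H)] C) (hch : ∀ T ∈ C, IsChannel T) :
    @IsCompact _ (moduleTopology ℂ (SuperOp H H)) C := by
  let _ : TopologicalSpace (SuperOp H H) := moduleTopology ℂ (SuperOp H H)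
  have : IsModuleTopology ℂ (SuperOp H H) := ⟨rfl⟩
  have : ContinuousAdd (SuperOp H H) := IsModuleTopology.toContinuousAdd ℂ (SuperOp H H)
  let b := stdOrthonormalBasis ℂ H
  let ι := Fin (Module.finrank ℂ H)
  -- The matrix elements of a super-operator.
  let Φ : SuperOp H H →ₗ[ℂ] (ι × ι × ι × ι → ℂ) :=
    { toFun := fun T x => inner ℂ (b x.1) (T (outer (b x.2.1) (b x.2.2.1)) (b x.2.2.2))
      map_add' := fun S T => by ext x; simp
      map_smul' := fun c T => by ext x; simp }
  have hΦ : LinearMap.ker Φ = ⊥ := by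
    refine LinearMap.ker_eq_bot'.2 fun T hT => ?_
    have h1 : ∀ j k, T (outer (b j) (b k)) = 0 := by
      intro j k
      refine b.toBasis.ext fun l => ?_
      rw [OrthonormalBasis.coe_toBasis, ← b.sum_repr' (T (outer (b j) (b k)) (b l))]
      refine Finset.sum_eq_zero fun i _ => ?_
      rw [show inner ℂ (b i) (T (outer (b j) (b k)) (b l)) = 0 from congrFun hT (i, j, k, l),
        zero_smul]
    refine linearMap_ext_outer fun x y => ?_
    have h2 : outer x y = ∑ j, ∑ k, (inner ℂ (b j) x * inner ℂ y (b k)) • outer (b j) (b k) := by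
      refine b.toBasis.ext fun l => ?_
      simp only [OrthonormalBasis.coe_toBasis, LinearMap.sum_apply, LinearMap.smul_apply,
        outer_apply, b.inner_eq_ite]
      simp only [ite_smul, one_smul, zero_smul, smul_ite, smul_zero, Finset.sum_ite_eq',
        Finset.mem_univ, if_true]
      conv_lhs => rw [← b.sum_repr' x, Finset.smul_sum]
      exact Finset.sum_congr rfl fun j _ => by rw [smul_smul, mul_comm]
    rw [h2]
    simp [h1]
  obtain ⟨Ψ, hΨ⟩ := Φ.exists_leftInverse_of_injective hΦ
  have hcont : Continuous Ψ := IsModuleTopology.continuous_of_linearMap Ψ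
  refine ((isCompact_closedBall (0 : ι × ι × ι × ι → ℂ) 1).image hcont).of_isClosed_subset hC ?_
  intro T hT
  refine ⟨Φ T, ?_, LinearMap.congr_fun hΨ T⟩
  rw [mem_closedBall_zero_iff, pi_norm_le_iff_of_nonneg zero_le_one]
  intro x
  refine (norm_inner_apply_outer_le (hch T hT) _ _ _ _).trans_eq ?_
  simp

/-- If every channel in a closed set fails to pass one of finitely many projective tests with
certainty, then it fails with a probability bounded from below. -/
theorem exists_uniform_damping {C : Set (SuperOp H H)}
    (hC : IsClosed[moduleTopology ℂ (SuperOp H H)] C) (hch : ∀ T ∈ C, IsChannel T)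
    {L : ℕ} {φ χ : ℕ → H} (hφ : ∀ n, ‖φ n‖ = 1) (hχ : ∀ n, ‖χ n‖ = 1)
    (hne : ∀ T ∈ C, ∃ k < L, (inner ℂ (χ k) (T (ketbra (φ k)) (χ k))).re ≠ 1) :
    ∃ κ : ℝ, 0 ≤ κ ∧ κ < 1 ∧
      ∀ T ∈ C, ∃ k < L, √(inner ℂ (χ k) (T (ketbra (φ k)) (χ k))).re ≤ κ := by
  rcases C.eq_empty_or_nonempty with rfl | hCne
  · exact ⟨0, le_rfl, one_pos, by simp⟩
  have hcomp := isCompact_of_isClosed_of_isChannel hC hch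
  let _ : TopologicalSpace (SuperOp H H) := moduleTopology ℂ (SuperOp H H)
  have : IsModuleTopology ℂ (SuperOp H H) := ⟨rfl⟩
  let r : ℕ → SuperOp H H → ℝ := fun k T => (inner ℂ (χ k) (T (ketbra (φ k)) (χ k))).re
  have hr : ∀ k, Continuous (r k) := by
    intro k
    let f : SuperOp H H →ₗ[ℂ] ℂ :=
      { toFun := fun T => inner ℂ (χ k) (T (ketbra (φ k)) (χ k))
        map_add' := fun S T => by simp
        map_smul' := fun c T => by simp }
    exact Complex.continuous_re.comp (IsModuleTopology.continuous_of_linearMap f)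
  have hg : Continuous fun T => ∑ k ∈ Finset.range L, (1 - r k T) :=
    continuous_finsetSum _ fun k _ => continuous_const.sub (hr k)
  obtain ⟨T₀, hT₀, hmin⟩ := hcomp.exists_isMinOn hCne hg.continuousOn
  have hnn : ∀ T ∈ C, ∀ k, 0 ≤ 1 - r k T := fun T hT k =>
    sub_nonneg.2 (re_inner_apply_ketbra_le_one (hch T hT) (hφ k) (hχ k))
  set δ := ∑ k ∈ Finset.range L, (1 - r k T₀) with hδ
  have hδ0 : 0 < δ := by
    obtain ⟨k, hk, hne⟩ := hne T₀ hT₀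
    refine Finset.sum_pos' (fun k _ => hnn T₀ hT₀ k) ⟨k, Finset.mem_range.2 hk, ?_⟩
    exact lt_of_le_of_ne (hnn T₀ hT₀ k) fun h => hne (by change r k T₀ = 1; linarith)
  have hL : (0 : ℝ) < L := by
    obtain ⟨k, hk, -⟩ := hne T₀ hT₀
    exact_mod_cast (Nat.zero_le k).trans_lt hk
  refine ⟨√(1 - δ / L), Real.sqrt_nonneg _, ?_, fun T hT => ?_⟩
  · rw [Real.sqrt_lt' one_pos]
    have : 0 < δ / L := by positivity
    linarith
  · by_contra! hcon
    have h1 : ∑ k ∈ Finset.range L, (1 - r k T) < ∑ _k ∈ Finset.range L, δ / L := by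
      refine Finset.sum_lt_sum_of_nonempty (Finset.nonempty_range_iff.2 ?_) fun k hk => ?_
      · rintro rfl; simp at hL
      · by_contra! hle
        exact absurd (hcon k (Finset.mem_range.1 hk))
          (not_lt.2 (Real.sqrt_le_sqrt (by change r k T ≤ _; linarith)))
    rw [Finset.sum_const, Finset.card_range, nsmul_eq_mul, mul_div_cancel₀ _ hL.ne'] at h1
    exact absurd (hmin hT) (not_le.2 h1)

/-! ### Operators on a subspace -/

theorem mem_opsOn_iff {V : Submodule ℂ H} {A : Op H} :
    A ∈ opsOn V ↔ LinearMap.range A ≤ V ∧ Vᗮ ≤ LinearMap.ker A := by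
  refine and_congr_right fun _ => ⟨fun h => ?_, fun h => ?_⟩
  · have := Submodule.orthogonal_le h
    rwa [Submodule.orthogonal_orthogonal] at this
  · have := Submodule.orthogonal_le h
    rwa [Submodule.orthogonal_orthogonal] at this

theorem outer_mem_opsOn {V : Submodule ℂ H} {x y : H} (hx : x ∈ V) (hy : y ∈ V) :
    outer x y ∈ opsOn V := by
  refine mem_opsOn_iff.2 ⟨?_, fun z hz => ?_⟩
  · rintro _ ⟨z, rfl⟩
    rw [outer_apply]
    exact V.smul_mem _ hx
  · rw [LinearMap.mem_ker, outer_apply, (Submodule.mem_orthogonal V z).1 hz y hy, zero_smul]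

theorem outer_polarization (x y : H) :
    outer x y = (1 / 4 : ℂ) • (ketbra (x + y) - ketbra (x - y)
      + Complex.I • (ketbra (x + Complex.I • y) - ketbra (x - Complex.I • y))) := by
  refine LinearMap.ext fun z => ?_
  simp only [ketbra, outer_apply, LinearMap.smul_apply, LinearMap.add_apply, LinearMap.sub_apply,
    inner_add_left, inner_sub_left, inner_smul_left, Complex.conj_I]
  match_scalars
  all_goals ring_nf
  all_goals simp
  all_goals ring

theorem opsOn_subset_span_ketbra (V : Submodule ℂ H) :
    opsOn V ⊆ Submodule.span ℂ (ketbra '' {x : H | x ∈ V ∧ ‖x‖ = 1}) := by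
  set M := Submodule.span ℂ (ketbra '' {x : H | x ∈ V ∧ ‖x‖ = 1}) with hM
  have hk : ∀ x ∈ V, ketbra x ∈ M := by
    intro x hx
    rcases eq_or_ne x 0 with rfl | hx0
    · have : ketbra (0 : H) = 0 := by ext; simp [ketbra, outer_apply]
      rw [this]
      exact M.zero_mem
    · have hn : ‖x‖ ≠ 0 := norm_ne_zero_iff.2 hx0
      have h1 : x = ((‖x‖ : ℝ) : ℂ) • (((‖x‖⁻¹ : ℝ) : ℂ) • x) := by
        rw [smul_smul, ← Complex.ofReal_mul, mul_inv_cancel₀ hn, Complex.ofReal_one, one_smul]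
      rw [h1, ketbra_smul]
      refine M.smul_mem _ (Submodule.subset_span ⟨_, ⟨V.smul_mem _ hx, ?_⟩, rfl⟩)
      rw [norm_smul, Complex.norm_real, norm_inv, norm_norm, inv_mul_cancel₀ hn]
  have ho : ∀ x ∈ V, ∀ y ∈ V, outer x y ∈ M := by
    intro x hx y hy
    have hy' := V.smul_mem Complex.I hy
    rw [outer_polarization]
    exact M.smul_mem _ (M.add_mem
      (M.sub_mem (hk _ (V.add_mem hx hy)) (hk _ (V.sub_mem hx hy)))
      (M.smul_mem _ (M.sub_mem (hk _ (V.add_mem hx hy')) (hk _ (V.sub_mem hx hy')))))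
  intro ρ hρ
  obtain ⟨hr, hker⟩ := mem_opsOn_iff.1 hρ
  let c := stdOrthonormalBasis ℂ V
  have hdec : ρ = ∑ i, outer (ρ (c i)) (c i : H) := by
    refine LinearMap.ext fun z => ?_
    have h1 : ρ z = ρ (V.starProjection z) := by
      rw [← sub_eq_zero, ← map_sub]
      exact hker (V.sub_starProjection_mem_orthogonal z)
    rw [h1, LinearMap.sum_apply]
    have h2 : (V.starProjection z : H) = ∑ i, inner ℂ (c i : H) z • (c i : H) := by
      have := c.sum_repr' (V.orthogonalProjectionOnto z)
      have h3 := congrArg (Subtype.val) this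
      rw [Submodule.starProjection_apply, ← h3, AddSubmonoidClass.coe_finsetSum]
      refine Finset.sum_congr rfl fun i _ => ?_
      rw [Submodule.coe_smul]
      congr 1
      exact Submodule.inner_orthogonalProjectionOnto_eq_of_mem_left (c i) z
    rw [h2, map_sum]
    exact Finset.sum_congr rfl fun i _ => by rw [map_smul, outer_apply]
  rw [hdec]
  exact M.sum_mem fun i _ => ho _ (hr ⟨_, rfl⟩) _ (c i).2

/-- Finitely many pure states span the operators on `V`; they are arranged periodically. -/
theorem exists_periodic_test_vectors {V : Submodule ℂ H} {v : H} (hv : v ∈ V) (hv1 : ‖v‖ = 1) :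
    ∃ (L : ℕ) (φ : ℕ → H), 0 < L ∧ (∀ n, φ n ∈ V) ∧ (∀ n, ‖φ n‖ = 1) ∧ (∀ n, φ (n % L) = φ n) ∧
      opsOn V ⊆ Submodule.span ℂ (Set.range fun n => ketbra (φ n)) := by
  classical
  obtain ⟨B, hB, hspan, hind⟩ :=
    exists_linearIndependent ℂ (ketbra '' {x : H | x ∈ V ∧ ‖x‖ = 1})
  have hfin : B.Finite := hind.setFinite
  obtain ⟨F, hF, hFfin, hFB⟩ := (Set.exists_subset_image_finite_and
    (p := fun s => s = B)).1 ⟨B, hB, hfin, rfl⟩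
  let G : Finset H := insert v hFfin.toFinset
  have hG : ∀ x ∈ G, x ∈ V ∧ ‖x‖ = 1 := by
    intro x hx
    rcases Finset.mem_insert.1 hx with rfl | hx
    · exact ⟨hv, hv1⟩
    · exact hF (hFfin.mem_toFinset.1 hx)
  have hpos : 0 < G.card := Finset.card_pos.2 ⟨v, Finset.mem_insert_self _ _⟩
  let e := G.equivFin
  let φ : ℕ → H := fun n => e.symm ⟨n % G.card, Nat.mod_lt _ hpos⟩
  refine ⟨G.card, φ, hpos, fun n => (hG _ (e.symm _).2).1, fun n => (hG _ (e.symm _).2).2,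
    fun n => by simp [φ], ?_⟩
  refine (opsOn_subset_span_ketbra V).trans ?_
  rw [← hspan, ← hFB]
  refine Submodule.span_mono ?_
  rintro _ ⟨x, hx, rfl⟩
  have hxG : x ∈ G := Finset.mem_insert_of_mem (hFfin.mem_toFinset.2 hx)
  refine ⟨e ⟨x, hxG⟩, ?_⟩
  have : (⟨(e ⟨x, hxG⟩ : ℕ) % G.card, Nat.mod_lt _ hpos⟩ : Fin G.card) = e ⟨x, hxG⟩ :=
    Fin.ext (Nat.mod_eq_of_lt (e ⟨x, hxG⟩).2)
  simp only [φ, this, Equiv.symm_apply_apply]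

theorem IsIsometricOn.exists_apply_outer {T : SuperOp H H} {V : Submodule ℂ H}
    (hT : IsIsometricOn T V) :
    ∃ W : V →ₗᵢ[ℂ] H, ∀ x y : V, T (outer (x : H) (y : H)) = outer (W x) (W y) := by
  obtain ⟨W, hW⟩ := hT
  refine ⟨W, fun x y => ?_⟩
  rw [hW _ (outer_mem_opsOn x.2 y.2), ← LinearIsometry.coe_toLinearMap, ← conjBy_outer]
  congr 1
  ext z
  simp [outer_apply]

end Estimates

/-! ### Error and interaction probabilities of the Zeno strategy -/

section Main

set_option linter.unusedSectionVars false

variable {H E : Type*} [NormedAddCommGroup H] [InnerProductSpace ℂ H] [FiniteDimensional ℂ H]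
  [NormedAddCommGroup E] [InnerProductSpace ℂ E] [FiniteDimensional ℂ E]

theorem interactionFunctional_combination (V : H →ₗᵢ[ℂ] E ⊗[ℂ] H) (v : H) (a b : ℂ) (ρ σ : Op H) :
    interactionFunctional V v (a • ρ + b • σ)
      = a * interactionFunctional V v ρ + b * interactionFunctional V v σ := by
  simp only [interactionFunctional_eq, map_add, map_smul, smul_eq_mul]
  ring

theorem IsStinespring.eq_tmul {T : SuperOp H H} {V : H →ₗᵢ[ℂ] E ⊗[ℂ] H} (hV : IsStinespring T V)
    {v w x p : H} (hw : ‖w‖ = 1) (hv : T (ketbra v) = ketbra w) (hx : T (outer x v) = outer p w)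
    (hn : ‖x‖ = ‖p‖) : ‖slice w (V v)‖ = 1 ∧ V x = slice w (V v) ⊗ₜ[ℂ] p := by
  refine eq_tmul_of_ptraceLeft_outer hw ?_ ?_ (by rw [V.norm_map, hn])
  · rw [← ketbra, ← ketbra, ← hv, hV, conjBy_ketbra, LinearIsometry.coe_toLinearMap]
  · rw [← hx, hV, conjBy_outer, LinearIsometry.coe_toLinearMap]

variable {N L : ℕ} {θ : ℝ} {v w : H} {φ χ : ℕ → H} {hv : ‖v‖ = 1} {hw : ‖w‖ = 1}
  {hφ : ∀ n, ‖φ n‖ = 1} {hχ : ∀ n, ‖χ n‖ = 1}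

/-- The vacuum block contributes nothing to the interaction probability, and the block of the test
vector contributes in proportion to its population. -/
theorem interactionProb_zeno_eq {V : H →ₗᵢ[ℂ] E ⊗[ℂ] H} {e : E} {w' : H} (he : ‖e‖ = 1)
    (hw' : ‖w'‖ = 1) (hVv : V v = e ⊗ₜ[ℂ] w') {q p : ℕ → ℝ}
    (hpop : ∀ n, HasPopulations ((zeno N θ v w φ χ hv hw hφ hχ).state (downOp V v) n) v (φ n)
      (q n) (p n)) :
    interactionProb V v (zeno N θ v w φ χ hv hw hφ hχ)
      = ∑ n ∈ Finset.range N, p n * (1 - ‖krausOf V e (φ n)‖ ^ 2) := by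
  refine Finset.sum_congr rfl fun n _ => ?_
  rw [(hpop n).ptraceRight_eq, interactionFunctional_combination,
    interactionFunctional_ketbra he hw' hVv, interactionFunctional_ketbra he hw' hVv,
    krausOf_of_eq_tmul he hVv, hv, hw', hφ n]
  rw [← Complex.ofReal_mul, ← Complex.ofReal_mul, ← Complex.ofReal_add, Complex.ofReal_re]
  ring

theorem isQuantumOperation_downOp {V : H →ₗᵢ[ℂ] E ⊗[ℂ] H} {e : E} {w' : H} (he : ‖e‖ = 1)
    (hw' : ‖w'‖ = 1) (hVv : V v = e ⊗ₜ[ℂ] w') : IsQuantumOperation (downOp V v) := by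
  rw [downOp_of_eq_tmul he hw' hVv]
  exact isQuantumOperation_conjBy (norm_krausOf_le V he)

/-- On an isometric channel every test vector leaves the environment in the same state as the
vacuum. -/
theorem interactionProb_zeno_of_isometric {T : SuperOp H H} {V : H →ₗᵢ[ℂ] E ⊗[ℂ] H}
    (hV : IsStinespring T V) (h00 : T (outer v v) = outer w w)
    (h10 : ∀ n, T (outer (φ n) v) = outer (χ n) w) :
    interactionProb V v (zeno N θ v w φ χ hv hw hφ hχ) = 0 := by
  obtain ⟨he, hVv⟩ := hV.eq_tmul hw h00 h00 (by rw [hv, hw])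
  obtain ⟨q, p, hpop, -⟩ :=
    exists_zeno_populations N θ hv hw hφ hχ (isQuantumOperation_downOp he hw hVv)
  rw [interactionProb_zeno_eq he hw hVv hpop]
  refine Finset.sum_eq_zero fun n _ => ?_
  have hVφ := (hV.eq_tmul hw h00 (h10 n) (by rw [hφ n, hχ n])).2
  rw [krausOf_of_eq_tmul he hVφ, hχ n]
  norm_num

/-- The population of the test vector under a quantum operation that fails one of the tests in each
period with a fixed probability. -/
theorem exists_zeno_populations_le (hθ : 0 ≤ θ) {κ : ℝ} (hκ0 : 0 ≤ κ) (hκ1 : κ < 1)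
    {S : SuperOp H H} (hS : IsQuantumOperation S)
    (hr : ∀ n, (inner ℂ (χ n) (S (ketbra (φ n)) (χ n))).re ≤ 1)
    (hL : ∀ n, ∃ k < L, √(inner ℂ (χ (n + k)) (S (ketbra (φ (n + k))) (χ (n + k)))).re ≤ κ) :
    ∃ q p : ℕ → ℝ,
      (∀ n, HasPopulations ((zeno N θ v w φ χ hv hw hφ hχ).state S n) v (φ n) (q n) (p n)) ∧
      ∀ n, p n ≤ (L / (1 - κ) * θ) ^ 2 := by
  obtain ⟨q, p, hpop, h0, hs⟩ := exists_zeno_populations N θ hv hw hφ hχ hS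
  have hsin : |Real.sin θ| ≤ θ := by
    have := Real.abs_sin_le_abs (x := θ)
    rwa [abs_of_nonneg hθ] at this
  refine ⟨q, p, hpop, fun n => ?_⟩
  have h := le_of_damped_recursion (t := fun n => √(p n))
    (κ := fun n => √(inner ℂ (χ n) (S (ketbra (φ n)) (χ n))).re) hθ
    (fun n => Real.sqrt_nonneg _) (h0.trans hsin) (fun n => (hs n).trans (by gcongr))
    (fun n => Real.sqrt_le_one.2 (hr n)) hκ0 hκ1 hL n
  have hd : 0 < 1 - κ := by linarith
  exact (Real.sqrt_le_left (by positivity)).1 h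

/-- Periodicity turns a failing test among the first `L` ones into one in every window of length
`L`. -/
theorem exists_window_of_periodic {P : ℕ → Prop} (hP : ∀ n, P (n % L) ↔ P n)
    (h : ∃ k < L, P k) (n : ℕ) : ∃ k < L, P (n + k) := by
  obtain ⟨k, hk, hPk⟩ := h
  have hL : 0 < L := by omega
  refine ⟨(k + (L - n % L)) % L, Nat.mod_lt _ hL, ?_⟩
  rw [← hP]
  have h1 : (n + (k + (L - n % L)) % L) % L = k := by
    have h2 := Nat.mod_lt n hL
    rw [Nat.add_mod_mod, ← Nat.mod_add_mod,
      show n % L + (k + (L - n % L)) = k + L by omega, Nat.add_mod_right, Nat.mod_eq_of_lt hk]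
  rwa [h1]

end Main

end

end InteractionFree

/-- Discrimination strategy. The topology on the finite-dimensional space of linear maps
`B(H) → B(H)` is the canonical one (the one given by any norm). The ancillary space is one qubit,
and the interaction probability is computed from an arbitrary Stinespring isometry. -/
theorem theorem2p4 {H : Type*} [NormedAddCommGroup H] [InnerProductSpace ℂ H]
    [FiniteDimensional ℂ H]
    (CA CB : Set (InteractionFree.SuperOp H H))
    (hCA : IsClosed[moduleTopology ℂ (InteractionFree.SuperOp H H)] CA)
    (hCB : IsClosed[moduleTopology ℂ (InteractionFree.SuperOp H H)] CB)
    (𝒱 : Submodule ℂ H) (v : H) (hv : v ∈ 𝒱)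
    (h_vacuum : ∀ T ∈ CA ∪ CB, InteractionFree.IsChannelWithVacuum T v)
    (h_isometric : ∀ T ∈ CA, InteractionFree.IsIsometricOn T 𝒱)
    (h_one : ∃ S, InteractionFree.restrictions 𝒱 CA = {S})
    (h_disjoint : Disjoint (InteractionFree.restrictions 𝒱 CA)
      (InteractionFree.restrictions 𝒱 CB)) :
    (∃ C : ℝ, ∀ N : ℕ, 1 ≤ N →
      ∃ (i o : ℕ)
        (D : InteractionFree.Strategy N H (InteractionFree.Cn 2) (InteractionFree.Cn i)
          (InteractionFree.Cn o))
        (P : InteractionFree.POVM2 (InteractionFree.Cn o)),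
        InteractionFree.errorProb CA CB D P ≤ C / (N : ℝ) ^ 2 ∧
        (∀ T ∈ CA, ∀ (E : Type) [NormedAddCommGroup E] [InnerProductSpace ℂ E]
          [FiniteDimensional ℂ E] (V : H →ₗᵢ[ℂ] E ⊗[ℂ] H),
          InteractionFree.IsStinespring T V → InteractionFree.interactionProb V v D = 0) ∧
        (∀ T ∈ CB, ∀ (E : Type) [NormedAddCommGroup E] [InnerProductSpace ℂ E]
          [FiniteDimensional ℂ E] (V : H →ₗᵢ[ℂ] E ⊗[ℂ] H),
          InteractionFree.IsStinespring T V →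
            InteractionFree.interactionProb V v D ≤ C / (N : ℝ))) ∧
    InteractionFree.InteractionFreeDiscriminable v CA CB := by
  open InteractionFree in
  have hmain : ∃ C : ℝ, ∀ N : ℕ, 1 ≤ N →
      ∃ (i o : ℕ) (D : Strategy N H (Cn 2) (Cn i) (Cn o)) (P : POVM2 (Cn o)),
        errorProb CA CB D P ≤ C / (N : ℝ) ^ 2 ∧
        (∀ T ∈ CA, ∀ (E : Type) [NormedAddCommGroup E] [InnerProductSpace ℂ E]
          [FiniteDimensional ℂ E] (V : H →ₗᵢ[ℂ] E ⊗[ℂ] H),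
          IsStinespring T V → interactionProb V v D = 0) ∧
        (∀ T ∈ CB, ∀ (E : Type) [NormedAddCommGroup E] [InnerProductSpace ℂ E]
          [FiniteDimensional ℂ E] (V : H →ₗᵢ[ℂ] E ⊗[ℂ] H),
          IsStinespring T V → interactionProb V v D ≤ C / (N : ℝ)) := by
    obtain ⟨S, hS⟩ := h_one
    obtain ⟨TA, hTA, hTAS⟩ : S ∈ restrictions 𝒱 CA := hS ▸ rfl
    have hv1 : ‖v‖ = 1 := (h_vacuum TA (Or.inl hTA)).2.1
    have hCBch : ∀ T ∈ CB, IsChannel T := fun T hT => (h_vacuum T (Or.inr hT)).1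
    obtain ⟨W, hW⟩ := (h_isometric TA hTA).exists_apply_outer
    -- All maps in `CA` act on `B(𝒱)` through the same isometry `W`.
    have hWall : ∀ T ∈ CA, ∀ x y : 𝒱, T (outer (x : H) (y : H)) = outer (W x) (W y) := by
      intro T hT x y
      have h1 : (opsOn 𝒱).domRestrict (T : Op H → Op H) ∈ restrictions 𝒱 CA := ⟨T, hT, rfl⟩
      rw [hS, Set.mem_singleton_iff, ← hTAS] at h1
      rw [← hW]
      exact congrFun h1 ⟨_, outer_mem_opsOn x.2 y.2⟩
    obtain ⟨L, φ, hL, hφV, hφ, hφL, hspan⟩ := exists_periodic_test_vectors hv hv1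
    let w : H := W ⟨v, hv⟩
    let χ : ℕ → H := fun n => W ⟨φ n, hφV n⟩
    have hw : ‖w‖ = 1 := by rw [W.norm_map]; exact hv1
    have hχ : ∀ n, ‖χ n‖ = 1 := fun n => by rw [W.norm_map]; exact hφ n
    have hχL : ∀ n, χ (n % L) = χ n := fun n => congrArg W (Subtype.ext (hφL n))
    -- A channel in `CB` that passes all tests agrees with `TA` on `B(𝒱)`.
    have hne : ∀ T ∈ CB, ∃ k < L, (inner ℂ (χ k) (T (ketbra (φ k)) (χ k))).re ≠ 1 := by
      intro T hT
      by_contra! hcon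
      obtain ⟨m, V, hV⟩ := (hCBch T hT).exists_isStinespring
      have heq : ∀ n, T (ketbra (φ n)) = TA (ketbra (φ n)) := by
        intro n
        rw [← hφL n, apply_ketbra_eq_of_inner_eq_one hV (hφ _) (hχ _)
          (hcon (n % L) (Nat.mod_lt _ hL))]
        exact (hW ⟨_, hφV (n % L)⟩ ⟨_, hφV (n % L)⟩).symm
      have hres : (opsOn 𝒱).domRestrict (T : Op H → Op H)
          = (opsOn 𝒱).domRestrict (TA : Op H → Op H) := by
        ext1 ρ
        refine LinearMap.eqOn_span (f := T) (g := TA) ?_ (hspan ρ.2)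
        rintro _ ⟨n, rfl⟩
        exact heq n
      exact Set.disjoint_left.1 h_disjoint ⟨TA, hTA, rfl⟩ ⟨T, hT, hres⟩
    obtain ⟨κ, hκ0, hκ1, hκ⟩ := exists_uniform_damping hCB hCBch hφ hχ hne
    have hd : 0 < 1 - κ := by linarith
    refine ⟨(L / (1 - κ) * (Real.pi / 2)) ^ 2, fun N hN => ?_⟩
    have hN0 : (0 : ℝ) < N := by exact_mod_cast hN
    let θ : ℝ := Real.pi / 2 / N
    have hθ0 : 0 ≤ θ := by positivity
    have hNθ : N * θ = Real.pi / 2 := mul_div_cancel₀ _ hN0.ne'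
    have hbound : (L / (1 - κ) * θ) ^ 2 = (L / (1 - κ) * (Real.pi / 2)) ^ 2 / (N : ℝ) ^ 2 := by
      rw [← div_pow, mul_div_assoc]
    have hwindow : ∀ T ∈ CB, ∀ n, ∃ k < L,
        √(inner ℂ (χ (n + k)) (T (ketbra (φ (n + k))) (χ (n + k)))).re ≤ κ := fun T hT n =>
      exists_window_of_periodic
        (P := fun n => √(inner ℂ (χ n) (T (ketbra (φ n)) (χ n))).re ≤ κ)
        (fun n => by rw [hφL, hχL]) (hκ T hT) n
    refine ⟨1, 2, zeno N θ v w φ χ hv1 hw hφ hχ, readoutPOVM, ?_, ?_, ?_⟩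
    · have hA : sSup ((fun T => (LinearMap.trace ℂ (Cn 2) (readoutPOVM.πB ∘ₗ
          (zeno N θ v w φ χ hv1 hw hφ hχ).output T)).re) '' CA) ≤ 0 := by
        refine Real.sSup_le ?_ le_rfl
        rintro _ ⟨T, hT, rfl⟩
        have h := trace_πB_zeno_output_of_isometric (hv := hv1) (hw := hw) (hφ := hφ) (hχ := hχ)
          hN hNθ (hWall T hT ⟨v, hv⟩ ⟨v, hv⟩) (fun n => hWall T hT ⟨v, hv⟩ ⟨φ n, hφV n⟩)
          (fun n => hWall T hT ⟨φ n, hφV n⟩ ⟨v, hv⟩)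
          (fun n => hWall T hT ⟨φ n, hφV n⟩ ⟨φ n, hφV n⟩)
        exact (congrArg Complex.re h).le
      have hB : sSup ((fun T => (LinearMap.trace ℂ (Cn 2) (readoutPOVM.πA ∘ₗ
          (zeno N θ v w φ χ hv1 hw hφ hχ).output T)).re) '' CB)
            ≤ (L / (1 - κ) * (Real.pi / 2)) ^ 2 / (N : ℝ) ^ 2 := by
        refine Real.sSup_le ?_ (by positivity)
        rintro _ ⟨T, hT, rfl⟩
        have hr := fun n => re_inner_apply_ketbra_le_one (hCBch T hT) (hφ n) (hχ n)
        obtain ⟨q, p, hpop, hp⟩ := exists_zeno_populations_le (N := N) (hv := hv1) (hw := hw)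
          (hφ := hφ) (hχ := hχ) hθ0 hκ0 hκ1 (hCBch T hT).isQuantumOperation hr (hwindow T hT)
        have hp' := (hpop (N - 1)).nonneg_one
        change (LinearMap.trace ℂ (Cn 2) _).re ≤ _
        rw [trace_πA_zeno_output, (hpop (N - 1)).inner_ampl, Complex.re_ofReal_mul, ← hbound]
        exact (mul_le_of_le_one_right hp' (hr _)).trans (hp _)
      have hC : 0 ≤ (L / (1 - κ) * (Real.pi / 2)) ^ 2 / (N : ℝ) ^ 2 := by positivity
      rw [errorProb]
      linarith
    · intro T hT E _ _ _ V hV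
      exact interactionProb_zeno_of_isometric hV (hWall T hT ⟨v, hv⟩ ⟨v, hv⟩)
        (fun n => hWall T hT ⟨φ n, hφV n⟩ ⟨v, hv⟩)
    · intro T hT E _ _ _ V hV
      obtain ⟨-, -, w', hw', hvw⟩ := h_vacuum T (Or.inr hT)
      obtain ⟨he, hVv⟩ := hV.eq_tmul hw' hvw hvw (by rw [hv1, hw'])
      -- `T↓` keeps only one Kraus operator of `T`, so that it passes each test less often.
      have hle : ∀ n, (inner ℂ (χ n) (downOp V v (ketbra (φ n)) (χ n))).re
          ≤ (inner ℂ (χ n) (T (ketbra (φ n)) (χ n))).re := by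
        intro n
        refine le_trans (le_of_eq ?_) (norm_inner_krausOf_sq_le hV he (φ n) (χ n))
        rw [downOp_of_eq_tmul he hw' hVv, conjBy_ketbra, ketbra, outer_apply, inner_smul_right,
          ← inner_conj_symm (krausOf V _ (φ n)) (χ n), ← Complex.normSq_eq_conj_mul_self,
          Complex.ofReal_re, Complex.normSq_eq_norm_sq]
      obtain ⟨q, p, hpop, hp⟩ := exists_zeno_populations_le (N := N) (hv := hv1) (hw := hw)
        (hφ := hφ) (hχ := hχ) hθ0 hκ0 hκ1 (isQuantumOperation_downOp he hw' hVv)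
        (fun n => (hle n).trans (re_inner_apply_ketbra_le_one (hCBch T hT) (hφ n) (hχ n)))
        (fun n => (hwindow T hT n).imp fun k hk =>
          ⟨hk.1, (Real.sqrt_le_sqrt (hle (n + k))).trans hk.2⟩)
      rw [interactionProb_zeno_eq he hw' hVv hpop]
      have hterm : ∀ n ∈ Finset.range N, p n * (1 - ‖krausOf V (slice w' (V v)) (φ n)‖ ^ 2)
          ≤ (L / (1 - κ) * (Real.pi / 2)) ^ 2 / (N : ℝ) ^ 2 := by
        intro n _
        rw [← hbound]
        refine (mul_le_of_le_one_right (hpop n).nonneg_one ?_).trans (hp n)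
        linarith [sq_nonneg ‖krausOf V (slice w' (V v)) (φ n)‖]
      refine (Finset.sum_le_sum hterm).trans_eq ?_
      rw [Finset.sum_const, Finset.card_range, nsmul_eq_mul]
      field_simp
  refine ⟨hmain, fun ε hε δ hδ => ?_⟩
  obtain ⟨C, hC⟩ := hmain
  obtain ⟨n, hn⟩ := exists_nat_gt (|C| / min ε δ)
  have hm : 0 < min ε δ := lt_min hε hδ
  have hN1 : (1 : ℝ) ≤ (n + 1 : ℕ) := by exact_mod_cast Nat.le_add_left 1 n
  have hlt : |C| / (n + 1 : ℕ) < min ε δ := by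
    rw [div_lt_iff₀ (by positivity)]
    rw [div_lt_iff₀ hm] at hn
    push_cast
    linarith
  have hC1 : C / (n + 1 : ℕ) < min ε δ := by
    refine lt_of_le_of_lt ?_ hlt
    gcongr
    exact le_abs_self C
  have hC2 : C / ((n + 1 : ℕ) : ℝ) ^ 2 < min ε δ := by
    refine lt_of_le_of_lt ?_ hlt
    refine (div_le_div_of_nonneg_right (le_abs_self C) (by positivity)).trans ?_
    exact div_le_div_of_nonneg_left (abs_nonneg C) (by positivity)
      (le_self_pow₀ hN1 two_ne_zero)
  obtain ⟨i, o, D, P, he, hA, hB⟩ := hC (n + 1) (Nat.le_add_left 1 n)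
  refine ⟨n + 1, 2, i, o, Nat.le_add_left 1 n, D, P,
    he.trans_lt (hC2.trans_le (min_le_left _ _)), ?_⟩
  rintro T (hT | hT) E _ _ _ V hV
  · rw [hA T hT E V hV]
    exact hδ
  · exact (hB T hT E V hV).trans_lt (hC1.trans_le (min_le_right _ _))
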